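/- Let $(M^3,g)$ and $(N^2,h)$ be smooth Riemannian manifolds of dimension 3 and 2, and let $\pi:(M^3,g)\to(N^2,h)$ be a Riemannian submersion, i.e. a smooth submersion whose differential is isometric on the orthogonal complement of its kernel. Let $U\subseteq M$ be open and let $\{e_1,e_2,e_3\}$ be a natural orthonormal frame on $U$, i.e. a smooth orthonormal frame on $U$ with $e_1,e_2$ horizontal (orthogonal to $\ker d\pi$) and $e_3$ vertical ($d\pi(e_3)=0$). Its generalized integrability data are the functions on $U$ $$f_1=g([e_1,e_2],e_1),\quad f_2=g([e_1,e_2],e_2),\quad f_3=g([e_1,e_3],e_2),$$ $$\kappa_1=g([e_1,e_3],e_3),\quad \kappa_2=g([e_2,e_3],e_3),\quad \sigma=-\tfrac12\, g([e_1,e_2],e_3).$$ Conventions: $R(X,Y)Z=\nabla_X\nabla_YZ-\nabla_Y\nabla_XZ-\nabla_{[X,Y]}Z$ for the Levi-Civita connection $\nabla$ of $g$, and $R^M(X,Y,Z,W)=g(R(X,Y)W,Z)$, so that $R^M(e_1,e_2,e_1,e_2)$ is the sectional curvature of the plane spanned by $e_1,e_2$; $K^N$ is the Gauss curvature of $(N,h)$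 composed with $\pi$; $\pi$ is harmonic on $U$ if its tension field $\tau(\pi)=\mathrm{Trace}_g\nabla d\pi$ vanishes on $U$ (for $U=M$: $\pi$ is a harmonic map). Then on $U$ $$[e_1,e_3]=f_3e_2+\kappa_1e_3,\quad [e_2,e_3]=-f_3e_1+\kappa_2e_3,\quad [e_1,e_2]=f_1e_1+f_2e_2-2\sigma e_3,$$ $$K^N=e_1(f_2)-e_2(f_1)-f_1^2-f_2^2+2f_3\sigma,$$ and the following hold. (1) If $\pi$ is harmonic on $U$, then on $U$ $$\begin{cases} R^M(e_1,e_3,e_1,e_2)=-e_1(\sigma),\\ R^M(e_1,e_3,e_1,e_3)=\sigma^2,\\ R^M(e_1,e_3,e_2,e_3)=-e_3(\sigma)=0,\\ R^M(e_1,e_2,e_1,e_2)=K^N-3\sigma^2,\\ R^M(e_1,e_2,e_2,e_3)=-e_2(\sigma),\\ R^M(e_2,e_3,e_1,e_3)=e_3(\sigma)=0,\\ R^M(e_2,e_3,e_2,e_3)=\sigma^2. \end{cases}\qquad(*)$$ (2) Conversely, if $\sigma\neq0$ at every point of $U$ and the system $(*)$ holds on $U$, then $\pi$ is harmonic on $U$.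 -/

import Mathlib

open scoped Bundle Manifold ContDiff

namespace HarmonicSubmersion

open Bundle VectorField

noncomputable section

/-! ### The Levi-Civita connection, built from the Koszul formula -/

variable {E : Type*} [NormedAddCommGroup E] [NormedSpace ℝ E]
  {H : Type*} [TopologicalSpace H] (I : ModelWithCorners ℝ E H)
  {M : Type*} [TopologicalSpace M] [ChartedSpace H M]

section
variable {I}
variable [IsManifold I ∞ M] [RiemannianBundle (fun x : M ↦ TangentSpace I x)]
  [IsContMDiffRiemannianBundle I ∞ E (fun x : M ↦ TangentSpace I x)]

theorem mdiffAt_inner {X Y : (x : M) → TangentSpace I x} {x : M}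
    (hX : MDiffAt (T% X) x) (hY : MDiffAt (T% Y) x) :
    MDiffAt (fun y ↦ inner ℝ (X y) (Y y)) x :=
  MDifferentiableAt.inner_bundle (IB := I) (F := E) (E := fun x : M ↦ TangentSpace I x)
    (b := fun y ↦ y) hX hY

end

variable [FiniteDimensional ℝ E]

section
variable [IsManifold I 1 M] [RiemannianBundle (fun x : M ↦ TangentSpace I x)]

instance tangentFinite (x : M) : FiniteDimensional ℝ (TangentSpace I x) :=
  inferInstanceAs (FiniteDimensional ℝ E)

/-- Half of the right-hand side of the Koszul formula
`2 g(∇_X Y, Z) = X g(Y, Z) + Y g(X, Z) - Z g(X, Y) + g([X,Y], Z) - g([X,Z], Y) - g([Y,Z], X)`. -/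
def koszul (X Y Z : (x : M) → TangentSpace I x) (x : M) : ℝ :=
  (1 / 2) *
    (mvfderiv I (fun y ↦ inner ℝ (Y y) (Z y)) x (X x)
      + mvfderiv I (fun y ↦ inner ℝ (X y) (Z y)) x (Y x)
      - mvfderiv I (fun y ↦ inner ℝ (X y) (Y y)) x (Z x)
      + inner ℝ (mlieBracket I X Y x) (Z x)
      - inner ℝ (mlieBracket I X Z x) (Y x)
      - inner ℝ (mlieBracket I Y Z x) (X x))

/-- The endomorphism `v ↦ ∇_v Y` of the tangent space at `x`: its matrix in an orthonormal basis
of the tangent space is given by the Koszul expression. -/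
def leviCivitaFun (Y : (x : M) → TangentSpace I x) (x : M) :
    TangentSpace I x →L[ℝ] TangentSpace I x :=
  let b := stdOrthonormalBasis ℝ (TangentSpace I x)
  ∑ i, ∑ j, koszul I (FiberBundle.extend E (b i)) Y (FiberBundle.extend E (b j)) x •
    (innerSL ℝ (b i)).smulRight (b j)
end

variable [IsManifold I ∞ M] [RiemannianBundle (fun x : M ↦ TangentSpace I x)]
  [IsContMDiffRiemannianBundle I ∞ E (fun x : M ↦ TangentSpace I x)]

variable {I}

theorem koszul_tensorial_left {Y Z : (x : M) → TangentSpace I x} {x : M}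
    (hY : MDiffAt (T% Y) x) (hZ : MDiffAt (T% Z) x) :
    TensorialAt I E (koszul I · Y Z x) x where
  smul {f X} hf hX := by
    have := mdiffAt_inner hX hZ
    have := mdiffAt_inner hX hY
    simp [koszul, inner_smul_left, inner_smul_right, mvfderiv_fun_mul, *,
      mlieBracket_smul_left hf hX, inner_add_left]
    ring
  add {X X'} hX hX' := by
    have := mdiffAt_inner hX hZ
    have := mdiffAt_inner hX hY
    have := mdiffAt_inner hX' hZ
    have := mdiffAt_inner hX' hY
    simp [koszul, inner_add_left, inner_add_right, mvfderiv_fun_add, *,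
      mlieBracket_add_left hX hX']
    ring

theorem koszul_tensorial_right {X Y : (x : M) → TangentSpace I x} {x : M}
    (hX : MDiffAt (T% X) x) (hY : MDiffAt (T% Y) x) :
    TensorialAt I E (koszul I X Y · x) x where
  smul {f Z} hf hZ := by
    have := mdiffAt_inner hX hZ
    have := mdiffAt_inner hY hZ
    simp [koszul, inner_smul_left, inner_smul_right, mvfderiv_fun_mul, *,
      mlieBracket_smul_right hf hZ, inner_add_left]
    rw [real_inner_comm (Y x) (Z x), real_inner_comm (X x) (Z x)]
    ring
  add {Z Z'} hZ hZ' := by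
    have := mdiffAt_inner hX hZ
    have := mdiffAt_inner hY hZ
    have := mdiffAt_inner hX hZ'
    have := mdiffAt_inner hY hZ'
    simp [koszul, inner_add_left, inner_add_right, mvfderiv_fun_add, *,
      mlieBracket_add_right hZ hZ']
    ring

theorem koszul_add {X Y Y' Z : (x : M) → TangentSpace I x} {x : M}
    (hX : MDiffAt (T% X) x) (hY : MDiffAt (T% Y) x) (hY' : MDiffAt (T% Y') x)
    (hZ : MDiffAt (T% Z) x) :
    koszul I X (Y + Y') Z x = koszul I X Y Z x + koszul I X Y' Z x := by
  have := mdiffAt_inner hY hZ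
  have := mdiffAt_inner hX hY
  have := mdiffAt_inner hY' hZ
  have := mdiffAt_inner hX hY'
  simp [koszul, inner_add_left, inner_add_right, mvfderiv_fun_add, *,
      mlieBracket_add_left hY hY', mlieBracket_add_right hY hY']
  ring

theorem koszul_smul {X Y Z : (x : M) → TangentSpace I x} {f : M → ℝ} {x : M}
    (hX : MDiffAt (T% X) x) (hY : MDiffAt (T% Y) x) (hf : MDiffAt f x)
    (hZ : MDiffAt (T% Z) x) :
    koszul I X (f • Y) Z x =
      f x * koszul I X Y Z x + mvfderiv I f x (X x) * inner ℝ (Y x) (Z x) := by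
  have := mdiffAt_inner hY hZ
  have := mdiffAt_inner hX hY
  simp [koszul, inner_smul_left, inner_smul_right, mvfderiv_fun_mul, *,
      mlieBracket_smul_left hf hY, mlieBracket_smul_right hf hY, inner_add_left]
  rw [real_inner_comm (Y x) (X x)]
  ring

variable (I M) in
/-- The Levi-Civita connection of a Riemannian manifold; `leviCivita I M Y x v` is `∇_v Y` at `x`.
It is torsion-free and metric, see `leviCivita_torsion` and `leviCivita_isMetricCompatible`. -/
def leviCivita : CovariantDerivative I E (TangentSpace I : M → Type _) where
  toFun := leviCivitaFun I
  isCovariantDerivativeOnUniv :=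
    { add := by
        intro Y Y' x hY hY' _
        simp [leviCivitaFun, koszul_add, hY, hY', FiberBundle.mdifferentiableAt_extend, add_smul,
          Finset.sum_add_distrib]
      leibniz := by
        intro Y f x hY hf _
        ext v
        let b := stdOrthonormalBasis ℝ (TangentSpace I x)
        have h1 : mvfderiv I f x v = ∑ i, inner ℝ (b i) v * mvfderiv I f x (b i) := by
          conv_lhs => rw [← b.sum_repr' v]
          simp [map_sum]
        have h2 : Y x = ∑ j, inner ℝ (Y x) (b j) • b j := by
          conv_lhs => rw [← b.sum_repr' (Y x)]
          simp [real_inner_comm]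
        have h3 : (mvfderiv I f x v) • Y x =
            ∑ i, ∑ j, ((mvfderiv I f x (b i) * inner ℝ (Y x) (b j)) * inner ℝ (b i) v) • b j := by
          conv_lhs => rw [h2, h1, Finset.sum_smul]
          simp only [Finset.smul_sum, smul_smul]
          refine Finset.sum_congr rfl fun i _ ↦ Finset.sum_congr rfl fun j _ ↦ ?_
          congr 1
          ring
        simp only [leviCivitaFun, koszul_smul, hY, hf, FiberBundle.mdifferentiableAt_extend,
          add_apply, smul_apply,
          sum_apply, ContinuousLinearMap.smulRight_apply, add_smul,
          Finset.sum_add_distrib, FiberBundle.extend_apply_self, smul_smul, innerSL_apply_apply,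
          Finset.smul_sum, mul_assoc] at h3 ⊢
        rw [h3] }

/-- The Koszul formula. -/
theorem inner_leviCivita {X Y Z : (x : M) → TangentSpace I x} {x : M}
    (hX : MDiffAt (T% X) x) (hY : MDiffAt (T% Y) x) (hZ : MDiffAt (T% Z) x) :
    inner ℝ (leviCivita I M Y x (X x)) (Z x) = koszul I X Y Z x := by
  let b := stdOrthonormalBasis ℝ (TangentSpace I x)
  let K := TensorialAt.mkHom₂ (fun X Z ↦ koszul I X Y Z x) x
    (fun Z hZ ↦ koszul_tensorial_left hY hZ) (fun X hX ↦ koszul_tensorial_right hX hY)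
  have h : koszul I X Y Z x = K (X x) (Z x) := (TensorialAt.mkHom₂_apply (Φ := fun X Z ↦ koszul I X Y Z x) _ _ hX hZ).symm
  have h' : ∀ u v, koszul I (FiberBundle.extend E u) Y (FiberBundle.extend E v) x = K u v :=
    fun u v ↦ (TensorialAt.mkHom₂_apply_eq_extend (Φ := fun X Z ↦ koszul I X Y Z x) _ _ u v).symm
  rw [h]
  have h4 : K (X x) (Z x) =
      ∑ i, ∑ j, inner ℝ (b i) (X x) * (inner ℝ (b j) (Z x) * K (b i) (b j)) := by
    conv_lhs => rw [← b.sum_repr' (X x), ← b.sum_repr' (Z x)]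
    simp only [map_sum, map_smul, sum_apply, smul_apply,
      smul_eq_mul]
    rw [Finset.sum_comm]
    refine Finset.sum_congr rfl fun i _ ↦ ?_
    rw [Finset.mul_sum]
    refine Finset.sum_congr rfl fun j _ ↦ ?_
    ring
  rw [h4]
  change inner ℝ (leviCivitaFun I Y x (X x)) (Z x) = _
  simp only [leviCivitaFun, h', smul_apply,
    sum_apply, ContinuousLinearMap.smulRight_apply, sum_inner,
    inner_smul_left, innerSL_apply_apply]
  congr! 2
  simp [b]
  ring

theorem leviCivita_torsion : (leviCivita I M).torsion = 0 := by
  rw [CovariantDerivative.torsion_eq_zero_iff]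
  intro X Y x hX hY
  refine ext_inner_right ℝ fun v ↦ ?_
  have hv := FiberBundle.mdifferentiableAt_extend I E v
  have h1 := inner_leviCivita hX hY hv
  have h2 := inner_leviCivita hY hX hv
  rw [FiberBundle.extend_apply_self] at h1 h2
  rw [inner_sub_left, h1, h2]
  simp only [koszul, FiberBundle.extend_apply_self, real_inner_comm]
  rw [mlieBracket_swap_apply (V := Y) (W := X)]
  simp only [inner_neg_right]
  ring

theorem leviCivita_isMetricCompatible :
    CovariantDerivative.IsMetricCompatible (V := fun x : M ↦ TangentSpace I x)
      (leviCivita I M) := by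
  rw [CovariantDerivative.isMetricCompatible_iff]
  intro x X Y Z hX hY hZ
  have h1 := inner_leviCivita hX hY hZ
  have h2 := inner_leviCivita hX hZ hY
  rw [real_inner_comm] at h2
  change _ = inner ℝ (leviCivita I M Y x (X x)) (Z x) + inner ℝ (Y x) (leviCivita I M Z x (X x))
  rw [h1, h2]
  simp only [koszul]
  rw [mlieBracket_swap_apply (V := Z) (W := Y)]
  simp only [inner_neg_left]
  simp only [real_inner_comm]
  ring

/-! ### Curvature

The sign conventions are `R(X, Y)Z = ∇_X ∇_Y Z - ∇_Y ∇_X Z - ∇_[X,Y] Z` and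
`R(X, Y, Z, W) = g(R(X, Y)W, Z)`, so that `R(u, v, u, v)` is the sectional curvature of the plane
spanned by orthonormal vectors `u`, `v`. -/

/-- The covariant derivative `∇_X Y` as a vector field. -/
def nabla (X Y : (x : M) → TangentSpace I x) (x : M) : TangentSpace I x :=
  leviCivita I M Y x (X x)

/-- The curvature `R(X, Y)Z`. -/
def curvature (X Y Z : (x : M) → TangentSpace I x) (x : M) : TangentSpace I x :=
  nabla X (nabla Y Z) x - nabla Y (nabla X Z) x - nabla (mlieBracket I X Y) Z x

/-- The curvature `R(X, Y, Z, W) = g(R(X, Y)W, Z)`. -/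
def curvature₄ (X Y Z W : (x : M) → TangentSpace I x) (x : M) : ℝ :=
  inner ℝ (curvature X Y W x) (Z x)

/-- The sectional curvature of the plane spanned by two linearly independent tangent vectors
`u`, `v`, computed with arbitrary smooth local extensions of `u` and `v`. -/
def sectionalCurvature {x : M} (u v : TangentSpace I x) : ℝ :=
  curvature₄ (FiberBundle.extend E u) (FiberBundle.extend E v)
      (FiberBundle.extend E u) (FiberBundle.extend E v) x /
    (inner ℝ u u * inner ℝ v v - inner ℝ u v ^ 2)

/-! ### Harmonic maps and Riemannian submersions -/

variable {F : Type*} [NormedAddCommGroup F] [NormedSpace ℝ F] [FiniteDimensional ℝ F]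
  {G : Type*} [TopologicalSpace G] {J : ModelWithCorners ℝ F G}
  {N : Type*} [TopologicalSpace N] [ChartedSpace G N]
  [IsManifold J ∞ N] [RiemannianBundle (fun y : N ↦ TangentSpace J y)]
  [IsContMDiffRiemannianBundle J ∞ F (fun y : N ↦ TangentSpace J y)]

variable (I) in
/-- The connection `∇^φ` induced on `φ⁻¹TN` by the Levi-Civita connection of `N`: if the section
`s` along `φ` is `∑ a, sᵃ • (Eₐ ∘ φ)` in a local frame `(Eₐ)` of `TN` near `φ x`, then
`∇^φ_v s = ∑ a, (v(sᵃ) • Eₐ + sᵃ • ∇^N_{dφ(v)} Eₐ)`. -/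
def pullbackNabla (φ : M → N) (s : (x : M) → TangentSpace J (φ x)) (x : M)
    (v : TangentSpace I x) : TangentSpace J (φ x) :=
  let t := trivializationAt F (TangentSpace J : N → Type _) (φ x)
  let b := Module.finBasis ℝ F
  ∑ a, (mvfderiv I (fun x' ↦ t.localFrameCoeff J b a (φ x') (s x')) x v •
        t.localFrame b a (φ x) +
      t.localFrameCoeff J b a (φ x) (s x) •
        leviCivita J N (t.localFrame b a) (φ x) (mfderiv I J φ x v))

variable (I J) in
/-- The second fundamental form `(∇dφ)(X, Y) = ∇^φ_X (dφ(Y)) - dφ(∇^M_X Y)` of a map. -/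
def secondFundamentalForm (φ : M → N) (X Y : (x : M) → TangentSpace I x) (x : M) :
    TangentSpace J (φ x) :=
  pullbackNabla I φ (fun x' ↦ mfderiv I J φ x' (Y x')) x (X x) - mfderiv I J φ x (nabla X Y x)

variable (I J) in
/-- The tension field `τ(φ) = Trace_g ∇dφ`. -/
def tensionField (φ : M → N) (x : M) : TangentSpace J (φ x) :=
  let b := stdOrthonormalBasis ℝ (TangentSpace I x)
  ∑ i, secondFundamentalForm I J φ (FiberBundle.extend E (b i)) (FiberBundle.extend E (b i)) x

variable (I J) in
/-- A map is harmonic on an open set if its tension field vanishes there; for `U = univ` this says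
that it is a harmonic map. -/
def IsHarmonicOn (φ : M → N) (U : Set M) : Prop :=
  ∀ x ∈ U, tensionField I J φ x = 0

variable (I J) in
/-- A tangent vector is vertical if it is tangent to the fibre. -/
def IsVertical (φ : M → N) {x : M} (v : TangentSpace I x) : Prop :=
  mfderiv I J φ x v = 0

variable (I J) in
/-- A tangent vector is horizontal if it is orthogonal to all vertical vectors. -/
def IsHorizontal (φ : M → N) {x : M} (v : TangentSpace I x) : Prop :=
  ∀ w : TangentSpace I x, IsVertical I J φ w → inner ℝ v w = 0

variable (I J) in
/-- A Riemannian submersion: a smooth submersion whose differential is isometric on horizontal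
vectors. -/
structure IsRiemannianSubmersion (φ : M → N) : Prop where
  contMDiff : ContMDiff I J ∞ φ
  surjective : ∀ x, Function.Surjective (mfderiv I J φ x)
  isometric : ∀ (x : M) (u v : TangentSpace I x), IsHorizontal I J φ u → IsHorizontal I J φ v →
    (inner ℝ (mfderiv I J φ x u) (mfderiv I J φ x v) : ℝ) = inner ℝ u v

end

/-! ### Submersions from a 3-manifold to a surface -/

noncomputable section

variable {M : Type*} [TopologicalSpace M] [ChartedSpace (EuclideanSpace ℝ (Fin 3)) M]
  [IsManifold (𝓡 3) ∞ M] [RiemannianBundle (fun x : M ↦ TangentSpace (𝓡 3) x)]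
  [IsContMDiffRiemannianBundle (𝓡 3) ∞ (EuclideanSpace ℝ (Fin 3))
    (fun x : M ↦ TangentSpace (𝓡 3) x)]
  {N : Type*} [TopologicalSpace N] [ChartedSpace (EuclideanSpace ℝ (Fin 2)) N]
  [IsManifold (𝓡 2) ∞ N] [RiemannianBundle (fun y : N ↦ TangentSpace (𝓡 2) y)]
  [IsContMDiffRiemannianBundle (𝓡 2) ∞ (EuclideanSpace ℝ (Fin 2))
    (fun y : N ↦ TangentSpace (𝓡 2) y)]

/-- The Gauss curvature of a surface: the sectional curvature of its tangent plane, computed in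
the coordinate basis. -/
def gaussCurvature (y : N) : ℝ :=
  sectionalCurvature (I := 𝓡 2) (x := y)
    (EuclideanSpace.single 0 1 : EuclideanSpace ℝ (Fin 2))
    (EuclideanSpace.single 1 1 : EuclideanSpace ℝ (Fin 2))

/-- A natural orthonormal frame of `φ` on the open set `U`: a smooth orthonormal frame on `U` with
`e₁`, `e₂` horizontal and `e₃` vertical. -/
structure IsNaturalFrameOn (φ : M → N) (U : Set M)
    (e₁ e₂ e₃ : (x : M) → TangentSpace (𝓡 3) x) : Prop where
  smooth₁ : ContMDiffOn (𝓡 3) (𝓡 3).tangent ∞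
    (fun x ↦ (⟨x, e₁ x⟩ : TangentBundle (𝓡 3) M)) U
  smooth₂ : ContMDiffOn (𝓡 3) (𝓡 3).tangent ∞
    (fun x ↦ (⟨x, e₂ x⟩ : TangentBundle (𝓡 3) M)) U
  smooth₃ : ContMDiffOn (𝓡 3) (𝓡 3).tangent ∞
    (fun x ↦ (⟨x, e₃ x⟩ : TangentBundle (𝓡 3) M)) U
  orthonormal : ∀ x ∈ U, Orthonormal ℝ ![e₁ x, e₂ x, e₃ x]
  horizontal₁ : ∀ x ∈ U, IsHorizontal (𝓡 3) (𝓡 2) φ (e₁ x)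
  horizontal₂ : ∀ x ∈ U, IsHorizontal (𝓡 3) (𝓡 2) φ (e₂ x)
  vertical₃ : ∀ x ∈ U, IsVertical (𝓡 3) (𝓡 2) φ (e₃ x)

variable (M) in
/-- Six functions on the total space. -/
structure IntegrabilityData where
  f₁ : M → ℝ
  f₂ : M → ℝ
  f₃ : M → ℝ
  κ₁ : M → ℝ
  κ₂ : M → ℝ
  σ : M → ℝ

/-- The generalized integrability data of an orthonormal frame `e₁`, `e₂`, `e₃`, i.e. the
coefficients in `[e₁,e₃] = f₃ e₂ + κ₁ e₃`, `[e₂,e₃] = -f₃ e₁ + κ₂ e₃`,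
`[e₁,e₂] = f₁ e₁ + f₂ e₂ - 2σ e₃`. -/
def integrabilityData (e₁ e₂ e₃ : (x : M) → TangentSpace (𝓡 3) x) : IntegrabilityData M where
  f₁ x := inner ℝ (mlieBracket (𝓡 3) e₁ e₂ x) (e₁ x)
  f₂ x := inner ℝ (mlieBracket (𝓡 3) e₁ e₂ x) (e₂ x)
  f₃ x := inner ℝ (mlieBracket (𝓡 3) e₁ e₃ x) (e₂ x)
  κ₁ x := inner ℝ (mlieBracket (𝓡 3) e₁ e₃ x) (e₃ x)
  κ₂ x := inner ℝ (mlieBracket (𝓡 3) e₂ e₃ x) (e₃ x)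
  σ x := -(1 / 2) * inner ℝ (mlieBracket (𝓡 3) e₁ e₂ x) (e₃ x)

/-- The directional derivative `X(f)`. -/
def dirDeriv (X : (x : M) → TangentSpace (𝓡 3) x) (f : M → ℝ) (x : M) : ℝ :=
  mvfderiv (𝓡 3) f x (X x)

/-- The bracket relations satisfied by the generalized integrability data. -/
def BracketRelationsAt (e₁ e₂ e₃ : (x : M) → TangentSpace (𝓡 3) x) (D : IntegrabilityData M)
    (x : M) : Prop :=
  mlieBracket (𝓡 3) e₁ e₃ x = D.f₃ x • e₂ x + D.κ₁ x • e₃ x ∧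
  mlieBracket (𝓡 3) e₂ e₃ x = -D.f₃ x • e₁ x + D.κ₂ x • e₃ x ∧
  mlieBracket (𝓡 3) e₁ e₂ x = D.f₁ x • e₁ x + D.f₂ x • e₂ x - (2 * D.σ x) • e₃ x

/-- The system of curvature identities at the point `x`. -/
structure CurvatureSystemAt (φ : M → N) (e₁ e₂ e₃ : (x : M) → TangentSpace (𝓡 3) x)
    (σ : M → ℝ) (x : M) : Prop where
  eq1312 : curvature₄ e₁ e₃ e₁ e₂ x = -dirDeriv e₁ σ x
  eq1313 : curvature₄ e₁ e₃ e₁ e₃ x = σ x ^ 2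
  eq1323 : curvature₄ e₁ e₃ e₂ e₃ x = -dirDeriv e₃ σ x ∧ -dirDeriv e₃ σ x = 0
  eq1212 : curvature₄ e₁ e₂ e₁ e₂ x = gaussCurvature (φ x) - 3 * σ x ^ 2
  eq1223 : curvature₄ e₁ e₂ e₂ e₃ x = -dirDeriv e₂ σ x
  eq2313 : curvature₄ e₂ e₃ e₁ e₃ x = dirDeriv e₃ σ x ∧ dirDeriv e₃ σ x = 0
  eq2323 : curvature₄ e₂ e₃ e₂ e₃ x = σ x ^ 2

end

end HarmonicSubmersion

open Bundle HarmonicSubmersion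

namespace HarmonicSubmersion

open VectorField Filter
open scoped Topology

noncomputable section

/-! ### Lie brackets as commutators of derivations; brackets of related vector fields. -/

section Brackets

variable {E : Type*} [NormedAddCommGroup E] [NormedSpace ℝ E]
  {H : Type*} [TopologicalSpace H] {I : ModelWithCorners ℝ E H}
  {M : Type*} [TopologicalSpace M] [ChartedSpace H M]
  {E' : Type*} [NormedAddCommGroup E'] [NormedSpace ℝ E']

section

variable [I.Boundaryless]

/-! Everything is expressed through the structure functions g([eᵢ,eⱼ],eₖ) of an orthonormal frame.
The inner products of the frame are constant, so the Koszul formula makes the Christoffel symbols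
linear in the structure functions, and the curvature becomes first derivatives plus quadratic terms
(`IsOrthonormalFrameNear.curvature₄_eq`).

The submersion enters through basic frames, whose horizontal fields project to an orthonormal frame
of the base. Brackets of related fields are related (`mfderiv_mlieBracket_of_related`), so a basic
field has a vertical bracket with e₃, and horizontal structure functions are pulled back from N. A
natural frame agrees with a basic one at a chosen point and differs from it nearby by an orthogonal
matrix, whose derivative along e₃ is skew; hence the horizontal parts of [e₁,e₃] and [e₂,e₃] are
given by the single function f₃ (`structureFun_vertical_swap`).

With these relations and the Jacobi identity, `curvature₄_integrabilityData` gives in particular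
R(e₁,e₃,e₁,e₂) = -e₁(σ) + 2κ₁σ and R(e₁,e₂,e₂,e₃) = -e₂(σ) + 2κ₂σ, together with -2e₃(σ) = e₂(κ₁) -
e₁(κ₂) + κ₁f₁ + κ₂f₂. The component R(e₁,e₂,e₁,e₂) equals K^N - 3σ² for every Riemannian submersion
(O'Neill, `gaussCurvature_eq_add`), which also yields the formula for K^N.

The horizontal part of the second fundamental form of π vanishes, so the tension field is
-dπ(∇_{e₃}e₃) = -κ₁dπ(e₁) - κ₂dπ(e₂), and π is harmonic exactly where κ₁ = κ₂ = 0. Putting κ₁ = κ₂ =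
0 on the open set U in the curvature formulas gives the system. Conversely, the two displayed
components force κ₁σ = κ₂σ = 0. -/

theorem contDiffAt_comp_extChartAt_symm {f : M → E'} {x : M} (hf : CMDiffAt 2 f x) :
    ContDiffAt ℝ 2 (f ∘ (extChartAt I x).symm) (extChartAt I x x) := by
  have := (contMDiffAt_iff.1 hf).2
  simpa only [I.range_eq_univ, contDiffWithinAt_univ, extChartAt_model_space_eq_id,
    PartialEquiv.refl_coe, Function.id_comp] using this

variable [IsManifold I 2 M]

/-- The derivative of a function along a vector field, in a chart. -/
theorem mvfderiv_extChartAt_symm {f : M → E'} {V : (x : M) → TangentSpace I x} {x : M} {u : E}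
    (hu : u ∈ (extChartAt I x).target) (hf : MDiffAt f ((extChartAt I x).symm u)) :
    mvfderiv I f ((extChartAt I x).symm u) (V ((extChartAt I x).symm u)) =
      fderiv ℝ (f ∘ (extChartAt I x).symm) u
        (mpullbackWithin 𝓘(ℝ, E) I (extChartAt I x).symm V (Set.range I) u) := by
  have hi := isInvertible_mfderivWithin_extChartAt_symm hu
  have hs := mdifferentiableWithinAt_extChartAt_symm hu
  rw [mpullbackWithin_apply]
  simp only [I.range_eq_univ, mfderivWithin_univ, mdifferentiableWithinAt_univ] at hi hs ⊢
  rw [← mfderiv_eq_fderiv, mfderiv_comp u hf hs]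
  exact (congrArg (mfderiv I 𝓘(ℝ, E') f ((extChartAt I x).symm u))
    (hi.self_apply_inverse (V ((extChartAt I x).symm u)))).symm

theorem differentiableAt_mpullbackWithin [CompleteSpace E] {W : (x : M) → TangentSpace I x} {x : M}
    (hW : MDiffAt (T% W) x) :
    DifferentiableAt ℝ (mpullbackWithin 𝓘(ℝ, E) I (extChartAt I x).symm W (Set.range I))
      (extChartAt I x x) := by
  have := MDifferentiableWithinAt.differentiableWithinAt_mpullbackWithin_vectorField
    (mdifferentiableWithinAt_univ.2 hW)
  simp only [I.range_eq_univ, Set.preimage_univ, Set.inter_univ] at this ⊢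
  exact differentiableWithinAt_univ.1 this

theorem mvfderiv_comp_extChartAt_symm_eventuallyEq {f : M → E'} {W : (x : M) → TangentSpace I x}
    {x : M} (hf : CMDiffAt 2 f x) :
    (fun y ↦ mvfderiv I f y (W y)) ∘ (extChartAt I x).symm =ᶠ[𝓝 (extChartAt I x x)]
      fun u ↦ fderiv ℝ (f ∘ (extChartAt I x).symm) u
        (mpullbackWithin 𝓘(ℝ, E) I (extChartAt I x).symm W (Set.range I) u) := by
  have hdf : ∀ᶠ y in 𝓝 ((extChartAt I x).symm (extChartAt I x x)), MDiffAt f y := by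
    rw [extChartAt_to_inv]
    filter_upwards [(contMDiffAt_iff_contMDiffAt_nhds (by simp)).1 hf] with y hy
      using hy.mdifferentiableAt (by simp)
  filter_upwards [(continuousAt_extChartAt_symm (I := I) x).eventually hdf,
    extChartAt_target_mem_nhds x] with u h1 h2
  exact mvfderiv_extChartAt_symm h2 h1

/-- The derivative of a `C²` function along a differentiable vector field is differentiable. -/
theorem mdifferentiableAt_mvfderiv_apply [CompleteSpace E] {f : M → E'}
    {W : (x : M) → TangentSpace I x} {x : M} (hf : CMDiffAt 2 f x) (hW : MDiffAt (T% W) x) :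
    MDiffAt (fun y ↦ mvfderiv I f y (W y)) x := by
  have hdfd := ((contDiffAt_comp_extChartAt_symm hf).fderiv_right (m := 1)
    (by norm_num)).differentiableAt (by simp)
  have h3 := MDifferentiableAt.comp (I' := 𝓘(ℝ, E)) x
    (hdfd.clm_apply (differentiableAt_mpullbackWithin hW)).mdifferentiableAt
    (mdifferentiableAt_extChartAt (mem_chart_source H x))
  refine h3.congr_of_eventuallyEq ?_
  filter_upwards [(continuousAt_extChartAt (I := I) x).eventually
      (mvfderiv_comp_extChartAt_symm_eventuallyEq (W := W) hf),
    extChartAt_source_mem_nhds (I := I) x] with y h1 h2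
  have h4 := (extChartAt I x).left_inv h2
  simp only [Function.comp_apply] at h1 ⊢
  rw [← h1, h4]

/-- Product rule in a chart. The Hessian term is symmetric and drops out of the commutator; the term
with the derivative of W survives and forms the bracket. -/
theorem mvfderiv_mvfderiv_apply [CompleteSpace E] {f : M → E'}
    {V W : (x : M) → TangentSpace I x} {x : M} (hf : CMDiffAt 2 f x) (hW : MDiffAt (T% W) x) :
    mvfderiv I (fun y ↦ mvfderiv I f y (W y)) x (V x) =
      fderiv ℝ (fderiv ℝ (f ∘ (extChartAt I x).symm)) (extChartAt I x x)
        (mpullbackWithin 𝓘(ℝ, E) I (extChartAt I x).symm V (Set.range I) (extChartAt I x x))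
        (mpullbackWithin 𝓘(ℝ, E) I (extChartAt I x).symm W (Set.range I) (extChartAt I x x)) +
      fderiv ℝ (f ∘ (extChartAt I x).symm) (extChartAt I x x)
        (fderiv ℝ (mpullbackWithin 𝓘(ℝ, E) I (extChartAt I x).symm W (Set.range I))
          (extChartAt I x x)
          (mpullbackWithin 𝓘(ℝ, E) I (extChartAt I x).symm V (Set.range I)
            (extChartAt I x x))) := by
  have hdfd := ((contDiffAt_comp_extChartAt_symm hf).fderiv_right (m := 1)
    (by norm_num)).differentiableAt (by simp)
  have h5 := mvfderiv_extChartAt_symm (V := V) (f := fun y ↦ mvfderiv I f y (W y))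
    (mem_extChartAt_target x)
    (by rw [extChartAt_to_inv]; exact mdifferentiableAt_mvfderiv_apply hf hW)
  rw [(mvfderiv_comp_extChartAt_symm_eventuallyEq (W := W) hf).fderiv_eq,
    fderiv_clm_apply hdfd (differentiableAt_mpullbackWithin hW), extChartAt_to_inv] at h5
  exact h5.trans (add_comm (fderiv ℝ (f ∘ (extChartAt I x).symm) (extChartAt I x x) _) _)

theorem mvfderiv_mlieBracket_eq_fderiv {f : M → E'} {V W : (x : M) → TangentSpace I x} {x : M}
    (hf : CMDiffAt 2 f x) :
    mvfderiv I f x (mlieBracket I V W x) =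
      fderiv ℝ (f ∘ (extChartAt I x).symm) (extChartAt I x x)
        (lieBracket ℝ (mpullbackWithin 𝓘(ℝ, E) I (extChartAt I x).symm V (Set.range I))
          (mpullbackWithin 𝓘(ℝ, E) I (extChartAt I x).symm W (Set.range I))
          (extChartAt I x x)) := by
  have hfg : f =ᶠ[𝓝 x] (f ∘ (extChartAt I x).symm) ∘ extChartAt I x := by
    filter_upwards [extChartAt_source_mem_nhds (I := I) x] with y hy
    have h4 := (extChartAt I x).left_inv hy
    simp only [Function.comp_apply, h4]
  have h7 : mfderiv I 𝓘(ℝ, E') f x =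
      (fderiv ℝ (f ∘ (extChartAt I x).symm) (extChartAt I x x)).comp
        (mfderiv I 𝓘(ℝ, E) (extChartAt I x) x) := by
    rw [hfg.mfderiv_eq, mfderiv_comp (I' := 𝓘(ℝ, E)) x
      ((contDiffAt_comp_extChartAt_symm hf).differentiableAt (by simp)).mdifferentiableAt
      (mdifferentiableAt_extChartAt (mem_chart_source H x)), mfderiv_eq_fderiv]
    rfl
  have hi := isInvertible_mfderiv_extChartAt (I := I) (mem_extChartAt_source x)
  rw [← mlieBracketWithin_univ, mlieBracketWithin_apply]
  change mfderiv I 𝓘(ℝ, E') f x _ = _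
  rw [h7]
  refine (congrArg (fderiv ℝ (f ∘ (extChartAt I x).symm) (extChartAt I x x))
    (hi.self_apply_inverse _)).trans ?_
  simp only [I.range_eq_univ, Set.preimage_univ, Set.inter_univ]
  exact congrArg (fderiv ℝ (f ∘ (extChartAt I x).symm) (extChartAt I x x))
    (congrFun lieBracketWithin_univ (extChartAt I x x))

/-- The Lie bracket of two vector fields acts on functions as the commutator of derivations. -/
theorem mvfderiv_mlieBracket [CompleteSpace E] {f : M → E'} {V W : (x : M) → TangentSpace I x}
    {x : M} (hf : CMDiffAt 2 f x) (hV : MDiffAt (T% V) x) (hW : MDiffAt (T% W) x) :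
    mvfderiv I f x (mlieBracket I V W x) =
      mvfderiv I (fun y ↦ mvfderiv I f y (W y)) x (V x) -
        mvfderiv I (fun y ↦ mvfderiv I f y (V y)) x (W x) := by
  have hsymm : IsSymmSndFDerivAt ℝ (f ∘ (extChartAt I x).symm) (extChartAt I x x) :=
    (contDiffAt_comp_extChartAt_symm hf).isSymmSndFDerivAt (by simp)
  have h (A : E →L[ℝ] E →L[ℝ] E') (L : E →L[ℝ] E') (v w p q : E) (hA : A v w = A w v) :
      L (p - q) = A v w + L p - (A w v + L q) := by
    rw [hA, map_sub, add_sub_add_left_eq_sub]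
  exact (mvfderiv_mlieBracket_eq_fderiv hf).trans ((h _ _ _ _ _ _ (hsymm.eq _ _)).trans
    (congrArg₂ (· - ·) (mvfderiv_mvfderiv_apply hf hW).symm (mvfderiv_mvfderiv_apply hf hV).symm))

variable {F : Type*} [NormedAddCommGroup F] [NormedSpace ℝ F]
  {G : Type*} [TopologicalSpace G] {J : ModelWithCorners ℝ F G}
  {N : Type*} [TopologicalSpace N] [ChartedSpace G N] [J.Boundaryless] [IsManifold J 2 N]

/-- The Lie brackets of `φ`-related vector fields are `φ`-related. -/
theorem mfderiv_mlieBracket_of_related [CompleteSpace E] [CompleteSpace F] {φ : M → N} {x : M}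
    (hφ : CMDiffAt 2 φ x) {X Y : (x : M) → TangentSpace I x} {V W : (y : N) → TangentSpace J y}
    (hX : MDiffAt (T% X) x) (hY : MDiffAt (T% Y) x)
    (hV : MDiffAt (T% V) (φ x)) (hW : MDiffAt (T% W) (φ x))
    (hXV : ∀ᶠ y in 𝓝 x, mfderiv I J φ y (X y) = V (φ y))
    (hYW : ∀ᶠ y in 𝓝 x, mfderiv I J φ y (Y y) = W (φ y)) :
    mfderiv I J φ x (mlieBracket I X Y x) = mlieBracket J V W (φ x) := by
  -- A chart at `φ x` serves as a vector-valued test function: its derivative there is injective, so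
  -- two tangent vectors agree once they differentiate `h` equally.
  let h : N → F := fun y ↦ extChartAt J (φ x) y
  have hC : CMDiffAt 2 h (φ x) := contMDiffAt_extChartAt
  have hev : ∀ᶠ y in 𝓝 x, ∀ v : TangentSpace I y,
      mvfderiv I (h ∘ φ) y v = mvfderiv J h (φ y) (mfderiv I J φ y v) := by
    filter_upwards [(contMDiffAt_iff_contMDiffAt_nhds (by simp)).1 hφ,
      hφ.continuousAt.eventually ((contMDiffAt_iff_contMDiffAt_nhds (by simp)).1 hC)]
      with y h1 h2 v
    exact mfderiv_comp_apply y (h2.mdifferentiableAt (by simp)) (h1.mdifferentiableAt (by simp)) v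
  have hφd : MDiffAt φ x := hφ.mdifferentiableAt (by simp)
  have hstep : ∀ {X Y : (x : M) → TangentSpace I x} {V W : (y : N) → TangentSpace J y},
      MDiffAt (T% W) (φ x) → mfderiv I J φ x (X x) = V (φ x) →
      (∀ᶠ y in 𝓝 x, mfderiv I J φ y (Y y) = W (φ y)) →
      mvfderiv I (fun y ↦ mvfderiv I (h ∘ φ) y (Y y)) x (X x) =
        mvfderiv J (fun z ↦ mvfderiv J h z (W z)) (φ x) (V (φ x)) := by
    intro X Y V W hW hXV hYW
    have h1 : (fun y ↦ mvfderiv I (h ∘ φ) y (Y y)) =ᶠ[𝓝 x]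
        (fun z ↦ mvfderiv J h z (W z)) ∘ φ := by
      filter_upwards [hev, hYW] with y h2 h3
      rw [h2, h3]
      rfl
    have h2 := mfderiv_comp_apply (I'' := 𝓘(ℝ, F)) x (mdifferentiableAt_mvfderiv_apply hC hW) hφd (X x)
    rw [hXV] at h2
    rw [← h1.mfderiv_eq] at h2
    exact h2
  have h1 := mvfderiv_mlieBracket (hC.comp x hφ) hX hY
  rw [hstep hW hXV.self_of_nhds hYW, hstep hV hYW.self_of_nhds hXV,
    ← mvfderiv_mlieBracket hC hV hW, hev.self_of_nhds] at h1
  exact (isInvertible_mfderiv_extChartAt (I := J) (mem_extChartAt_source (φ x))).injective h1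

end

end Brackets

end

end HarmonicSubmersion

namespace HarmonicSubmersion

open VectorField Filter
open scoped Topology

noncomputable section

/-! ### Orthonormal frames: structure functions, Christoffel symbols and curvature. -/

section Frames

variable {E : Type*} [NormedAddCommGroup E] [NormedSpace ℝ E]
  {H : Type*} [TopologicalSpace H] {I : ModelWithCorners ℝ E H}
  {M : Type*} [TopologicalSpace M] [ChartedSpace H M]

/-- The vector field `X` is smooth in a neighbourhood of `x`. -/
def SmoothNear [IsManifold I 1 M] (X : (x : M) → TangentSpace I x) (x : M) : Prop :=
  ∀ᶠ y in 𝓝 x, CMDiffAt ∞ (T% X) y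

section

variable [IsManifold I ∞ M]

theorem SmoothNear.eventually {X : (x : M) → TangentSpace I x} {x : M} (h : SmoothNear X x) :
    ∀ᶠ y in 𝓝 x, SmoothNear X y :=
  h.eventually_nhds

theorem SmoothNear.contMDiffAt {X : (x : M) → TangentSpace I x} {x : M} (h : SmoothNear X x) :
    CMDiffAt ∞ (T% X) x :=
  h.self_of_nhds

theorem SmoothNear.mdifferentiableAt {X : (x : M) → TangentSpace I x} {x : M}
    (h : SmoothNear X x) : MDiffAt (T% X) x :=
  h.contMDiffAt.mdifferentiableAt (by simp)

theorem SmoothNear.congr {X Y : (x : M) → TangentSpace I x} {x : M} (h : SmoothNear X x)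
    (hXY : ∀ᶠ y in 𝓝 x, Y y = X y) : SmoothNear Y x := by
  filter_upwards [h, hXY.eventually_nhds] with y h1 h2
  refine h1.congr_of_eventuallyEq ?_
  filter_upwards [h2] with z hz
  rw [hz]

theorem smoothNear_extend {x : M} (v : TangentSpace I x) :
    SmoothNear (FiberBundle.extend E v) x := by
  obtain ⟨s, hs, h⟩ := FiberBundle.exists_contMDiffOn_extend (k := ∞) I E v
  filter_upwards [eventually_mem_nhds_iff.2 hs] with y hy using h.contMDiffAt hy

theorem SmoothNear.sum_smul {ι : Type*} {s : Finset ι} {x : M} {f : ι → M → ℝ}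
    {X : ι → (x : M) → TangentSpace I x} (hf : ∀ i, ∀ᶠ y in 𝓝 x, CMDiffAt ∞ (f i) y)
    (hX : ∀ i, SmoothNear (X i) x) : SmoothNear (fun y ↦ ∑ i ∈ s, f i y • X i y) x := by
  have hf' := (eventually_all_finset s).2 fun i _ ↦ hf i
  have hX' := (eventually_all_finset s).2 fun i _ ↦ hX i
  filter_upwards [hf', hX'] with y h1 h2
  exact ContMDiffAt.sum_section fun i hi ↦ (h1 i hi).smul_section (h2 i hi)

theorem mdifferentiableAt_sum_smul {ι : Type*} {s : Finset ι} {x : M} {f : ι → M → ℝ}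
    {X : ι → (x : M) → TangentSpace I x} (hf : ∀ i, MDiffAt (f i) x)
    (hX : ∀ i, MDiffAt (T% (X i)) x) :
    MDiffAt (T% (fun y ↦ ∑ i ∈ s, f i y • X i y)) x :=
  MDifferentiableAt.sum_section fun i _ ↦ (hf i).smul_section (hX i)

theorem SmoothNear.smul {x : M} {f : M → ℝ}
    {X : (x : M) → TangentSpace I x} (hf : ∀ᶠ y in 𝓝 x, CMDiffAt ∞ f y)
    (hX : SmoothNear X x) : SmoothNear (fun y ↦ f y • X y) x := by
  filter_upwards [hf, hX] with y h1 h2 using h1.smul_section h2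

theorem SmoothNear.sub {x : M} {X Y : (x : M) → TangentSpace I x}
    (hX : SmoothNear X x) (hY : SmoothNear Y x) : SmoothNear (fun y ↦ X y - Y y) x := by
  filter_upwards [hX, hY] with y h1 h2 using h1.sub_section h2

variable [FiniteDimensional ℝ E]

theorem SmoothNear.mlieBracket {X Y : (x : M) → TangentSpace I x} {x : M} (hX : SmoothNear X x)
    (hY : SmoothNear Y x) : SmoothNear (VectorField.mlieBracket I X Y) x := by
  have : CompleteSpace E := FiniteDimensional.complete ℝ E
  -- The bracket costs one derivative, but `∞ + 1` is again `∞`.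
  have : IsManifold I ((⊤ : ℕ∞) + 1) M := inferInstanceAs (IsManifold I ∞ M)
  have : IsManifold I (minSmoothness ℝ 2) M := by simp only [minSmoothness_of_isRCLikeNormedField]; infer_instance
  filter_upwards [hX, hY] with y h1 h2
  exact ContMDiffAt.mlieBracket_vectorField (m := ⊤) (n := ⊤) h1 h2 (by simp)

theorem mlieBracket_sum_smul_left {ι : Type*} {s : Finset ι} {x : M} {f : ι → M → ℝ}
    {X : ι → (x : M) → TangentSpace I x} {Y : (x : M) → TangentSpace I x}
    (hf : ∀ i, MDiffAt (f i) x) (hX : ∀ i, MDiffAt (T% (X i)) x) :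
    VectorField.mlieBracket I (fun y ↦ ∑ i ∈ s, f i y • X i y) Y x =
      ∑ i ∈ s, (f i x • VectorField.mlieBracket I (X i) Y x - mvfderiv I (f i) x (Y x) • X i x) := by
  classical
  have : CompleteSpace E := FiniteDimensional.complete ℝ E
  induction s using Finset.induction_on with
  | empty => exact congrFun (mlieBracket_zero_left (I := I) (W := Y)) x
  | insert a s ha ih =>
    rw [Finset.sum_insert ha, ← ih]
    simp only [Finset.sum_insert ha]
    have h1 := mlieBracket_add_left (W := Y) ((hf a).smul_section (hX a))
      (mdifferentiableAt_sum_smul (s := s) hf hX)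
    have h2 := mlieBracket_smul_left (W := Y) (hf a) (hX a)
    refine h1.trans ?_
    congr 1
    refine h2.trans ?_
    rw [neg_smul, neg_add_eq_sub]

end

variable [IsManifold I ∞ M] [RiemannianBundle (fun x : M ↦ TangentSpace I x)]

variable {ι : Type*} [Fintype ι]

/-- Vector fields which form a smooth orthonormal frame in a neighbourhood of `x`. -/
structure IsOrthonormalFrameNear (e : ι → (x : M) → TangentSpace I x) (x : M) : Prop where
  smooth : ∀ i, SmoothNear (e i) x
  orthonormal : ∀ᶠ y in 𝓝 x, Orthonormal ℝ (fun i ↦ e i y)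
  card_eq : Fintype.card ι = Module.finrank ℝ E

/-- The structure functions `g([eᵢ, eⱼ], eₖ)` of a frame. -/
def structureFun (e : ι → (x : M) → TangentSpace I x) (i j k : ι) (x : M) : ℝ :=
  inner ℝ (mlieBracket I (e i) (e j) x) (e k x)

/-- The Christoffel symbols `g(∇_{eᵢ} eⱼ, eₖ)` of an orthonormal frame in terms of its structure
functions. -/
def christoffel (e : ι → (x : M) → TangentSpace I x) (i j k : ι) (x : M) : ℝ :=
  (1 / 2) * (structureFun e i j k x - structureFun e i k j x - structureFun e j k i x)

namespace IsOrthonormalFrameNear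

variable {e : ι → (x : M) → TangentSpace I x} {x : M}

theorem eventually (h : IsOrthonormalFrameNear e x) : ∀ᶠ y in 𝓝 x, IsOrthonormalFrameNear e y := by
  filter_upwards [eventually_all.2 fun i ↦ (h.smooth i).eventually,
    h.orthonormal.eventually_nhds] with y h1 h2
  exact ⟨h1, h2, h.card_eq⟩

theorem mdifferentiableAt (h : IsOrthonormalFrameNear e x) (i : ι) : MDiffAt (T% (e i)) x :=
  (h.smooth i).mdifferentiableAt

theorem inner_eq [DecidableEq ι] (h : IsOrthonormalFrameNear e x) (i j : ι) :
    inner ℝ (e i x) (e j x) = if i = j then 1 else 0 :=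
  orthonormal_iff_ite.1 h.orthonormal.self_of_nhds i j

variable [FiniteDimensional ℝ E]

/-- The orthonormal basis of the tangent space given by an orthonormal frame. -/
def basis (h : IsOrthonormalFrameNear e x) : OrthonormalBasis ι ℝ (TangentSpace I x) :=
  OrthonormalBasis.mk h.orthonormal.self_of_nhds
    (h.orthonormal.self_of_nhds.linearIndependent.span_eq_top_of_card_eq_finrank' h.card_eq).ge

@[simp]
theorem basis_apply (h : IsOrthonormalFrameNear e x) (i : ι) : h.basis i = e i x := by
  simp [basis]

theorem sum_inner_smul (h : IsOrthonormalFrameNear e x) (v : TangentSpace I x) :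
    ∑ i, inner ℝ v (e i x) • e i x = v := by
  conv_rhs => rw [← h.basis.sum_repr' v]
  simp [real_inner_comm]

theorem ext_inner (h : IsOrthonormalFrameNear e x) {v w : TangentSpace I x}
    (hvw : ∀ i, (inner ℝ v (e i x) : ℝ) = inner ℝ w (e i x)) : v = w := by
  rw [← h.sum_inner_smul v, ← h.sum_inner_smul w]
  simp [hvw]

theorem mlieBracket_eq (h : IsOrthonormalFrameNear e x) (i j : ι) :
    mlieBracket I (e i) (e j) x = ∑ k, structureFun e i j k x • e k x :=
  (h.sum_inner_smul _).symm

end IsOrthonormalFrameNear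

section Connection

variable [IsContMDiffRiemannianBundle I ∞ E (fun x : M ↦ TangentSpace I x)]

theorem SmoothNear.contMDiffAt_inner {X Y : (x : M) → TangentSpace I x} {x : M}
    (hX : SmoothNear X x) (hY : SmoothNear Y x) :
    ∀ᶠ y in 𝓝 x, CMDiffAt ∞ (fun y ↦ inner ℝ (X y) (Y y)) y := by
  filter_upwards [hX, hY] with y h1 h2
  exact ContMDiffAt.inner_bundle (IB := I) (F := E) (E := fun x : M ↦ TangentSpace I x)
    (b := fun y ↦ y) h1 h2

variable [FiniteDimensional ℝ E]

theorem leviCivita_congr {X Y : (x : M) → TangentSpace I x} {x : M}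
    (hX : MDiffAt (T% X) x) (hXY : ∀ᶠ y in 𝓝 x, Y y = X y) :
    leviCivita I M Y x = leviCivita I M X x := by
  have hY : MDiffAt (T% Y) x := by
    refine hX.congr_of_eventuallyEq ?_
    filter_upwards [hXY] with z hz
    rw [hz]
  exact (leviCivita I M).isCovariantDerivativeOnUniv.congr_of_eventuallyEq hY hX univ_mem hXY

theorem leviCivita_sum_smul {κ : Type*} {s : Finset κ} {x : M} {f : κ → M → ℝ}
    {X : κ → (x : M) → TangentSpace I x} (hf : ∀ i, MDiffAt (f i) x)
    (hX : ∀ i, MDiffAt (T% (X i)) x) (v : TangentSpace I x) :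
    leviCivita I M (fun y ↦ ∑ i ∈ s, f i y • X i y) x v =
      ∑ i ∈ s, (f i x • leviCivita I M (X i) x v + mvfderiv I (f i) x v • X i x) := by
  classical
  have hc := (leviCivita I M).isCovariantDerivativeOnUniv
  induction s using Finset.induction_on with
  | empty => exact congrArg (· v) (hc.zero (x := x))
  | insert a s ha ih =>
    rw [Finset.sum_insert ha, ← ih]
    simp only [Finset.sum_insert ha]
    have h1 := hc.add (x := x) ((hf a).smul_section (hX a))
      (mdifferentiableAt_sum_smul (s := s) hf hX)
    have h2 := hc.leibniz (x := x) (hX a) (hf a)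
    refine (congrArg (· v) h1).trans ?_
    rw [add_apply]
    congr 1
    exact congrArg (· v) h2

namespace IsOrthonormalFrameNear

variable {e : ι → (x : M) → TangentSpace I x} {x : M}

theorem contMDiffAt_structureFun (h : IsOrthonormalFrameNear e x) (i j k : ι) :
    ∀ᶠ y in 𝓝 x, CMDiffAt ∞ (structureFun e i j k) y :=
  ((h.smooth i).mlieBracket (h.smooth j)).contMDiffAt_inner (h.smooth k)

theorem mdifferentiableAt_structureFun (h : IsOrthonormalFrameNear e x) (i j k : ι) :
    MDiffAt (structureFun e i j k) x :=
  (h.contMDiffAt_structureFun i j k).self_of_nhds.mdifferentiableAt (by simp)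

theorem contMDiffAt_christoffel (h : IsOrthonormalFrameNear e x) (i j k : ι) :
    ∀ᶠ y in 𝓝 x, CMDiffAt ∞ (christoffel e i j k) y := by
  filter_upwards [h.contMDiffAt_structureFun i j k, h.contMDiffAt_structureFun i k j,
    h.contMDiffAt_structureFun j k i] with y h1 h2 h3
  exact contMDiffAt_const.mul ((h1.sub h2).sub h3)

theorem mdifferentiableAt_christoffel (h : IsOrthonormalFrameNear e x) (i j k : ι) :
    MDiffAt (christoffel e i j k) x :=
  (h.contMDiffAt_christoffel i j k).self_of_nhds.mdifferentiableAt (by simp)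

theorem mvfderiv_christoffel (h : IsOrthonormalFrameNear e x) (i j k : ι) :
    mvfderiv I (christoffel e i j k) x = (1 / 2 : ℝ) • (mvfderiv I (structureFun e i j k) x -
      mvfderiv I (structureFun e i k j) x - mvfderiv I (structureFun e j k i) x) := by
  have h1 := h.mdifferentiableAt_structureFun i j k
  have h2 := h.mdifferentiableAt_structureFun i k j
  have h3 := h.mdifferentiableAt_structureFun j k i
  have h4 := mvfderiv_mul (mdifferentiableAt_const (c := (1 / 2 : ℝ))) ((h1.sub h2).sub h3)
  rw [mvfderiv_const, mvfderiv_sub (h1.sub h2) h3, mvfderiv_sub h1 h2, smul_zero, add_zero] at h4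
  exact h4

/-- The three derivative terms of the Koszul formula vanish because the inner products of the frame
are locally constant; only brackets remain. -/
theorem inner_leviCivita (h : IsOrthonormalFrameNear e x) (i j k : ι) :
    inner ℝ (leviCivita I M (e j) x (e i x)) (e k x) = christoffel e i j k x := by
  classical
  have hd : ∀ i j, mvfderiv I (fun y ↦ (inner ℝ (e i y) (e j y) : ℝ)) x = 0 := by
    intro i j
    have : (fun y ↦ (inner ℝ (e i y) (e j y) : ℝ)) =ᶠ[𝓝 x] fun _ ↦ if i = j then 1 else 0 := by
      filter_upwards [h.eventually] with y hy using hy.inner_eq i j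
    unfold mvfderiv
    rw [this.mfderiv_eq]
    exact mvfderiv_const _
  rw [HarmonicSubmersion.inner_leviCivita (h.mdifferentiableAt i) (h.mdifferentiableAt j)
    (h.mdifferentiableAt k), koszul]
  simp only [hd, zero_apply]
  simp only [christoffel, structureFun]
  ring

theorem leviCivita_eq (h : IsOrthonormalFrameNear e x) (i j : ι) :
    leviCivita I M (e j) x (e i x) = ∑ k, christoffel e i j k x • e k x := by
  rw [← h.sum_inner_smul (leviCivita I M (e j) x (e i x))]
  simp only [h.inner_leviCivita]

theorem nabla_eventuallyEq (h : IsOrthonormalFrameNear e x) (i j : ι) :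
    ∀ᶠ y in 𝓝 x, nabla (e i) (e j) y = ∑ k, christoffel e i j k y • e k y := by
  filter_upwards [h.eventually] with y hy using hy.leviCivita_eq i j

/-- `leviCivita` is assembled from an extension chosen separately at each point, which hides its
regularity; the smooth Christoffel symbols of a frame reveal it. -/
theorem smoothNear_nabla_frame (h : IsOrthonormalFrameNear e x) (i j : ι) :
    SmoothNear (nabla (e i) (e j)) x :=
  (SmoothNear.sum_smul (h.contMDiffAt_christoffel i j) h.smooth).congr (h.nabla_eventuallyEq i j)

theorem nabla_nabla (h : IsOrthonormalFrameNear e x) (i j l : ι) :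
    nabla (e i) (nabla (e j) (e l)) x = ∑ m, (christoffel e j l m x •
      (∑ k, christoffel e i m k x • e k x) + mvfderiv I (christoffel e j l m) x (e i x) • e m x) := by
  rw [nabla, leviCivita_congr (mdifferentiableAt_sum_smul (h.mdifferentiableAt_christoffel j l)
    h.mdifferentiableAt) (h.nabla_eventuallyEq j l), leviCivita_sum_smul
    (h.mdifferentiableAt_christoffel j l) h.mdifferentiableAt]
  simp only [h.leviCivita_eq]

/-- The curvature in terms of the structure functions of an orthonormal frame. -/
theorem curvature₄_eq (h : IsOrthonormalFrameNear e x) (i j k l : ι) :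
    curvature₄ (e i) (e j) (e k) (e l) x =
      mvfderiv I (christoffel e j l k) x (e i x) - mvfderiv I (christoffel e i l k) x (e j x) +
      ∑ m, (christoffel e j l m x * christoffel e i m k x -
        christoffel e i l m x * christoffel e j m k x -
        structureFun e i j m x * christoffel e m l k x) := by
  classical
  have h3 : nabla (mlieBracket I (e i) (e j)) (e l) x =
      ∑ m, structureFun e i j m x • ∑ k, christoffel e m l k x • e k x := by
    rw [nabla, h.mlieBracket_eq, map_sum]
    simp only [map_smul, h.leviCivita_eq]
  rw [curvature₄, curvature, h.nabla_nabla, h.nabla_nabla, h3]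
  simp only [inner_sub_left, sum_inner, inner_add_left, inner_smul_left, h.inner_eq,
    RCLike.conj_to_real, mul_ite, mul_one, mul_zero, Finset.sum_ite_eq', Finset.mem_univ, if_true,
    Finset.sum_add_distrib, Finset.sum_sub_distrib]
  ring

end IsOrthonormalFrameNear

end Connection

end Frames

end

end HarmonicSubmersion

namespace HarmonicSubmersion

open VectorField Filter
open scoped Topology

noncomputable section

/-! ### Tensoriality of the curvature. -/

section CurvatureTensor

variable {E : Type*} [NormedAddCommGroup E] [NormedSpace ℝ E] [FiniteDimensional ℝ E]
  {H : Type*} [TopologicalSpace H] {I : ModelWithCorners ℝ E H}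
  {M : Type*} [TopologicalSpace M] [ChartedSpace H M] [IsManifold I ∞ M]
  [RiemannianBundle (fun x : M ↦ TangentSpace I x)]
  [IsContMDiffRiemannianBundle I ∞ E (fun x : M ↦ TangentSpace I x)]
  {ι : Type*} [Fintype ι] {e : ι → (x : M) → TangentSpace I x} {x : M}

theorem curvature_swap (X Y Z : (x : M) → TangentSpace I x) (x : M) :
    curvature X Y Z x = -curvature Y X Z x := by
  simp only [curvature, nabla]
  rw [mlieBracket_swap_apply (V := X), map_neg]
  abel

theorem leviCivita_smul {f : M → ℝ} {X : (x : M) → TangentSpace I x}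
    (hf : MDiffAt f x) (hX : MDiffAt (T% X) x) (v : TangentSpace I x) :
    leviCivita I M (fun y ↦ f y • X y) x v =
      f x • leviCivita I M X x v + mvfderiv I f x v • X x :=
  congrArg (· v) ((leviCivita I M).isCovariantDerivativeOnUniv.leibniz (x := x) hX hf)

theorem leviCivita_add {X Y : (x : M) → TangentSpace I x}
    (hX : MDiffAt (T% X) x) (hY : MDiffAt (T% Y) x) (v : TangentSpace I x) :
    leviCivita I M (fun y ↦ X y + Y y) x v =
      leviCivita I M X x v + leviCivita I M Y x v :=
  congrArg (· v) ((leviCivita I M).isCovariantDerivativeOnUniv.add (x := x) hX hY)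

namespace IsOrthonormalFrameNear

/-- Since ∇ is linear in the direction, ∇_X eₖ is a combination of the smooth fields ∇_{eᵢ} eₖ with
the components of X as coefficients, so differentiability of X is enough. -/
theorem mdifferentiableAt_nabla_frame (h : IsOrthonormalFrameNear e x)
    {X : (x : M) → TangentSpace I x} (hX : MDiffAt (T% X) x) (k : ι) :
    MDiffAt (T% (nabla X (e k))) x := by
  refine (mdifferentiableAt_sum_smul (s := Finset.univ) (f := fun i y ↦ inner ℝ (X y) (e i y))
    (X := fun i ↦ nabla (e i) (e k)) (fun i ↦ mdiffAt_inner hX (h.mdifferentiableAt i))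
    fun i ↦ (h.smoothNear_nabla_frame i k).mdifferentiableAt).congr_of_eventuallyEq ?_
  filter_upwards [h.eventually] with y hy
  congr 1
  simp only [nabla]
  conv_lhs => rw [← hy.sum_inner_smul (X y)]
  rw [map_sum]
  simp only [map_smul]

/-- Covariant derivatives in terms of the components in an orthonormal frame. -/
theorem leviCivita_eq_sum (h : IsOrthonormalFrameNear e x) {Z : (x : M) → TangentSpace I x}
    (hZ : MDiffAt (T% Z) x) (v : TangentSpace I x) :
    leviCivita I M Z x v = ∑ k, (inner ℝ (Z x) (e k x) • leviCivita I M (e k) x v +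
      mvfderiv I (fun y ↦ (inner ℝ (Z y) (e k y) : ℝ)) x v • e k x) := by
  have hc : ∀ k, MDiffAt (fun y ↦ (inner ℝ (Z y) (e k y) : ℝ)) x :=
    fun k ↦ mdiffAt_inner hZ (h.mdifferentiableAt k)
  rw [← leviCivita_sum_smul (s := Finset.univ) hc h.mdifferentiableAt]
  refine congrArg (· v) (leviCivita_congr (mdifferentiableAt_sum_smul hc h.mdifferentiableAt) ?_)
  filter_upwards [h.eventually] with y hy using (hy.sum_inner_smul _).symm

theorem nabla_eventuallyEq_sum (h : IsOrthonormalFrameNear e x)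
    (X : (x : M) → TangentSpace I x) {Z : (x : M) → TangentSpace I x} (hZ : SmoothNear Z x) :
    ∀ᶠ y in 𝓝 x, nabla X Z y = ∑ k, (inner ℝ (Z y) (e k y) • nabla X (e k) y +
      mvfderiv I (fun y ↦ (inner ℝ (Z y) (e k y) : ℝ)) y (X y) • e k y) := by
  filter_upwards [h.eventually, hZ] with y h1 h2
  exact h1.leviCivita_eq_sum (h2.mdifferentiableAt (by simp)) _

variable [I.Boundaryless]

theorem mdifferentiableAt_mvfderiv_inner (h : IsOrthonormalFrameNear e x)
    {X Z : (x : M) → TangentSpace I x} (hX : MDiffAt (T% X) x) (hZ : SmoothNear Z x) (k : ι) :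
    MDiffAt (fun y ↦ mvfderiv I (fun y ↦ (inner ℝ (Z y) (e k y) : ℝ)) y (X y)) x := by
  have : CompleteSpace E := FiniteDimensional.complete ℝ E
  exact mdifferentiableAt_mvfderiv_apply
    ((hZ.contMDiffAt_inner (h.smooth k)).self_of_nhds.of_le ENat.LEInfty.out) hX

theorem mdifferentiableAt_nabla (h : IsOrthonormalFrameNear e x)
    {X Z : (x : M) → TangentSpace I x} (hX : MDiffAt (T% X) x) (hZ : SmoothNear Z x) :
    MDiffAt (T% (nabla X Z)) x := by
  refine (MDifferentiableAt.sum_section (s := Finset.univ)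
    (t := fun k y ↦ (inner ℝ (Z y) (e k y) : ℝ) • nabla X (e k) y +
      mvfderiv I (fun y ↦ (inner ℝ (Z y) (e k y) : ℝ)) y (X y) • e k y) fun k _ ↦
      mdifferentiableAt_add_section ?_ ?_).congr_of_eventuallyEq ?_
  · exact (mdiffAt_inner hZ.mdifferentiableAt (h.mdifferentiableAt k)).smul_section
      (h.mdifferentiableAt_nabla_frame hX k)
  · exact (h.mdifferentiableAt_mvfderiv_inner hX hZ k).smul_section (h.mdifferentiableAt k)
  · filter_upwards [h.nabla_eventuallyEq_sum X hZ] with y hy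
    rw [hy]

/-- The Leibniz rule applied twice to Z = ∑ ⟨Z,eₖ⟩ eₖ. The two middle terms are exchanged when X and
Y are, so they disappear from the curvature. -/
theorem nabla_nabla_eq_sum (h : IsOrthonormalFrameNear e x)
    {X Y Z : (x : M) → TangentSpace I x} (hY : MDiffAt (T% Y) x) (hZ : SmoothNear Z x) :
    nabla X (nabla Y Z) x = ∑ k, (inner ℝ (Z x) (e k x) • nabla X (nabla Y (e k)) x +
      mvfderiv I (fun y ↦ (inner ℝ (Z y) (e k y) : ℝ)) x (X x) • nabla Y (e k) x +
      mvfderiv I (fun y ↦ (inner ℝ (Z y) (e k y) : ℝ)) x (Y x) • nabla X (e k) x +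
      mvfderiv I (fun y ↦ mvfderiv I (fun y ↦ (inner ℝ (Z y) (e k y) : ℝ)) y (Y y)) x (X x) •
        e k x) := by
  have h1 : ∀ k, MDiffAt (fun y ↦ (inner ℝ (Z y) (e k y) : ℝ)) x :=
    fun k ↦ mdiffAt_inner hZ.mdifferentiableAt (h.mdifferentiableAt k)
  have h2 := fun k ↦ h.mdifferentiableAt_nabla_frame hY k
  have h3 := fun k ↦ h.mdifferentiableAt_mvfderiv_inner hY hZ k
  have h4 : ∀ᶠ y in 𝓝 x, nabla Y Z y =
      (∑ k, inner ℝ (Z y) (e k y) • nabla Y (e k) y) +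
      ∑ k, mvfderiv I (fun y ↦ (inner ℝ (Z y) (e k y) : ℝ)) y (Y y) • e k y := by
    filter_upwards [h.nabla_eventuallyEq_sum Y hZ] with y hy
    rw [hy, Finset.sum_add_distrib]
  have h5 := mdifferentiableAt_sum_smul (s := Finset.univ) h1 h2
  have h6 := mdifferentiableAt_sum_smul (s := Finset.univ) h3 h.mdifferentiableAt
  change leviCivita I M (nabla Y Z) x (X x) = _
  rw [leviCivita_congr (mdifferentiableAt_add_section h5 h6) h4]
  refine (leviCivita_add h5 h6 _).trans ?_
  rw [leviCivita_sum_smul h1 h2, leviCivita_sum_smul h3 h.mdifferentiableAt,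
    ← Finset.sum_add_distrib]
  refine Finset.sum_congr rfl fun k _ ↦ ?_
  simp only [nabla]
  abel

/-- The curvature `R(X, Y)Z` is tensorial in `Z`. -/
theorem curvature_eq_sum (h : IsOrthonormalFrameNear e x)
    {X Y Z : (x : M) → TangentSpace I x} (hX : MDiffAt (T% X) x) (hY : MDiffAt (T% Y) x)
    (hZ : SmoothNear Z x) :
    curvature X Y Z x = ∑ k, inner ℝ (Z x) (e k x) • curvature X Y (e k) x := by
  have : CompleteSpace E := FiniteDimensional.complete ℝ E
  have hb : nabla (mlieBracket I X Y) Z x = _ :=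
    (h.nabla_eventuallyEq_sum (mlieBracket I X Y) hZ).self_of_nhds
  rw [curvature, h.nabla_nabla_eq_sum hY hZ, h.nabla_nabla_eq_sum hX hZ, hb,
    ← Finset.sum_sub_distrib, ← Finset.sum_sub_distrib]
  refine Finset.sum_congr rfl fun k _ ↦ ?_
  -- The second derivatives of ⟨Z,eₖ⟩ combine to XY - YX, which is cancelled by the derivative along
  -- [X,Y] coming from the last curvature term.
  rw [mvfderiv_mlieBracket ((hZ.contMDiffAt_inner (h.smooth k)).self_of_nhds.of_le ENat.LEInfty.out)
    hX hY, curvature]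
  module

/-- The term Y(f)∇_X Z arising in ∇_Y(f∇_X Z) is cancelled by the one from [fX,Y] = f[X,Y] - Y(f)X.
-/
theorem curvature_tensorial (h : IsOrthonormalFrameNear e x)
    (Y : (x : M) → TangentSpace I x) {Z : (x : M) → TangentSpace I x} (hZ : SmoothNear Z x) :
    TensorialAt I E (fun X ↦ curvature X Y Z x) x where
  smul {f X} hf hX := by
    have : CompleteSpace E := FiniteDimensional.complete ℝ E
    have h1 : nabla Y (nabla (f • X) Z) x = f x • nabla Y (nabla X Z) x +
        mvfderiv I f x (Y x) • nabla X Z x := by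
      have h2 : nabla (f • X) Z = fun y ↦ f y • nabla X Z y := by
        funext y
        exact map_smul _ _ _
      rw [h2]
      exact leviCivita_smul hf (h.mdifferentiableAt_nabla hX hZ) _
    have h3 : nabla (f • X) (nabla Y Z) x = f x • nabla X (nabla Y Z) x := map_smul _ _ _
    rw [curvature, h1, h3, curvature]
    simp only [nabla]
    rw [mlieBracket_smul_left hf hX, map_add, map_smul, map_smul]
    module
  add {X X'} hX hX' := by
    have : CompleteSpace E := FiniteDimensional.complete ℝ E
    have h1 : nabla Y (nabla (X + X') Z) x = nabla Y (nabla X Z) x + nabla Y (nabla X' Z) x := by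
      have h2 : nabla (X + X') Z = fun y ↦ nabla X Z y + nabla X' Z y := by
        funext y
        exact map_add _ _ _
      rw [h2]
      exact leviCivita_add (h.mdifferentiableAt_nabla hX hZ) (h.mdifferentiableAt_nabla hX' hZ) _
    have h3 : nabla (X + X') (nabla Y Z) x = nabla X (nabla Y Z) x + nabla X' (nabla Y Z) x :=
      map_add _ _ _
    rw [curvature, h1, h3, curvature, curvature]
    simp only [nabla]
    rw [mlieBracket_add_left hX hX', map_add]
    abel

theorem curvature_tensorial_right (h : IsOrthonormalFrameNear e x)
    (X : (x : M) → TangentSpace I x) {Z : (x : M) → TangentSpace I x} (hZ : SmoothNear Z x) :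
    TensorialAt I E (fun Y ↦ curvature X Y Z x) x := by
  have h1 := h.curvature_tensorial X hZ
  refine ⟨fun hf hY ↦ ?_, fun hY hY' ↦ ?_⟩
  · simp only [curvature_swap X]
    rw [h1.smul hf hY, smul_neg]
  · simp only [curvature_swap X]
    rw [h1.add hY hY', neg_add]

/-- The curvature at a point only depends on the values of the vector fields at this point. -/
theorem curvature₄_congr (h : IsOrthonormalFrameNear e x)
    {X Y Z W X' Y' Z' W' : (x : M) → TangentSpace I x}
    (hX : MDiffAt (T% X) x) (hY : MDiffAt (T% Y) x) (hW : SmoothNear W x)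
    (hX' : MDiffAt (T% X') x) (hY' : MDiffAt (T% Y') x) (hW' : SmoothNear W' x)
    (hXX' : X x = X' x) (hYY' : Y x = Y' x) (hZZ' : Z x = Z' x) (hWW' : W x = W' x) :
    curvature₄ X Y Z W x = curvature₄ X' Y' Z' W' x := by
  have h1 : curvature X Y W x = curvature X' Y' W x :=
    TensorialAt.pointwise₂ (Φ := fun X Y ↦ curvature X Y W x)
      (fun Y _ ↦ h.curvature_tensorial Y hW) (fun X _ ↦ h.curvature_tensorial_right X hW)
      hX hX' hY hY' hXX' hYY'
  rw [curvature₄, curvature₄, h1, hZZ', h.curvature_eq_sum hX' hY' hW,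
    h.curvature_eq_sum hX' hY' hW', hWW']

end IsOrthonormalFrameNear

end CurvatureTensor

end

end HarmonicSubmersion

namespace HarmonicSubmersion

open VectorField Filter
open scoped Topology

noncomputable section

/-! ### Curvature of surfaces in orthonormal frames. -/

section Surfaces

variable {E : Type*} [NormedAddCommGroup E] [NormedSpace ℝ E]
  {H : Type*} [TopologicalSpace H] {I : ModelWithCorners ℝ E H}
  {M : Type*} [TopologicalSpace M] [ChartedSpace H M]
  [RiemannianBundle (fun x : M ↦ TangentSpace I x)] {x : M}

section

variable {ι : Type*} (e : ι → (x : M) → TangentSpace I x)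

theorem structureFun_self (i k : ι) : structureFun e i i k = 0 := by
  funext x
  simp [structureFun]

theorem structureFun_swap (i j k : ι) : structureFun e i j k = -structureFun e j i k := by
  funext x
  simp only [structureFun, Pi.neg_apply]
  rw [mlieBracket_swap_apply, inner_neg_left]

/-- Metric compatibility read in an orthonormal frame. -/
theorem christoffel_swap (i j k : ι) (x : M) :
    christoffel e i j k x = -christoffel e i k j x := by
  simp only [christoffel]
  rw [structureFun_swap e j k i, Pi.neg_apply]
  ring

end

/-- The vector field `X / ‖X‖`. -/
def normalizedField (X : (x : M) → TangentSpace I x) (x : M) : TangentSpace I x :=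
  (√(inner ℝ (X x) (X x)))⁻¹ • X x

theorem inner_normalizedField_self {X : (x : M) → TangentSpace I x} (h0 : X x ≠ 0) :
    (inner ℝ (normalizedField X x) (normalizedField X x) : ℝ) = 1 := by
  have h1 : 0 < (inner ℝ (X x) (X x) : ℝ) := real_inner_self_pos.2 h0
  simp only [normalizedField, inner_smul_left, inner_smul_right, RCLike.conj_to_real]
  field_simp
  rw [Real.sq_sqrt h1.le]

variable [IsManifold I ∞ M] [IsContMDiffRiemannianBundle I ∞ E (fun x : M ↦ TangentSpace I x)]

theorem SmoothNear.normalizedField {X : (x : M) → TangentSpace I x} (hX : SmoothNear X x)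
    (h0 : X x ≠ 0) : SmoothNear (normalizedField X) x := by
  have h1 : ∀ᶠ y in 𝓝 x, (inner ℝ (X y) (X y) : ℝ) ≠ 0 :=
    (hX.contMDiffAt_inner hX).self_of_nhds.continuousAt.eventually_ne (inner_self_ne_zero.2 h0)
  refine SmoothNear.smul ?_ hX
  filter_upwards [h1, hX.contMDiffAt_inner hX] with y hy hs
  have h2 : ContDiffAt ℝ ∞ (fun t : ℝ ↦ (√t)⁻¹) (inner ℝ (X y) (X y)) :=
    (Real.contDiffAt_sqrt hy).inv (Real.sqrt_ne_zero'.2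
      (lt_of_le_of_ne real_inner_self_nonneg hy.symm))
  exact ContMDiffAt.comp (g := fun t : ℝ ↦ (√t)⁻¹) (f := fun y ↦ (inner ℝ (X y) (X y) : ℝ)) y
    h2.contMDiffAt hs

/-- Gram-Schmidt: an orthonormal basis of a tangent plane of a surface extends to an orthonormal
frame. -/
theorem exists_isOrthonormalFrameNear (hE : Module.finrank ℝ E = 2)
    {v : Fin 2 → TangentSpace I x} (hv : Orthonormal ℝ v) :
    ∃ e : Fin 2 → (x : M) → TangentSpace I x, IsOrthonormalFrameNear e x ∧ ∀ i, e i x = v i := by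
  have hv' := orthonormal_iff_ite.1 hv
  have h00 : (inner ℝ (v 0) (v 0) : ℝ) = 1 := by simpa using hv' 0 0
  have h11 : (inner ℝ (v 1) (v 1) : ℝ) = 1 := by simpa using hv' 1 1
  have h10 : (inner ℝ (v 1) (v 0) : ℝ) = 0 := by simpa using hv' 1 0
  set A : (x : M) → TangentSpace I x := FiberBundle.extend E (v 0)
  have hA : SmoothNear A x := smoothNear_extend _
  have hAx : A x = v 0 := FiberBundle.extend_apply_self ..
  have hA0 : A x ≠ 0 := hAx ▸ hv.ne_zero 0
  set e₀ := normalizedField A with he₀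
  have h0 : SmoothNear e₀ x := hA.normalizedField hA0
  have h0x : e₀ x = v 0 := by
    simp only [he₀, normalizedField, hAx, h00, Real.sqrt_one, inv_one, one_smul]
  -- Since `v` is already orthonormal, neither the projection nor the normalization changes the
  -- values at `x`.
  set B : (x : M) → TangentSpace I x := fun y ↦ FiberBundle.extend E (v 1) y -
    (inner ℝ (FiberBundle.extend E (v 1) y) (e₀ y) : ℝ) • e₀ y with hBdef
  have hB : SmoothNear B x :=
    (smoothNear_extend _).sub (SmoothNear.smul ((smoothNear_extend _).contMDiffAt_inner h0) h0)
  have hBx : B x = v 1 := by simp [hBdef, h0x, h10]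
  have hB0 : B x ≠ 0 := hBx ▸ hv.ne_zero 1
  set e₁ := normalizedField B with he₁
  have h1 : SmoothNear e₁ x := hB.normalizedField hB0
  have h1x : e₁ x = v 1 := by
    simp only [he₁, normalizedField, hBx, h11, Real.sqrt_one, inv_one, one_smul]
  have hne : ∀ {X : (x : M) → TangentSpace I x}, SmoothNear X x → X x ≠ 0 →
      ∀ᶠ y in 𝓝 x, X y ≠ 0 := by
    intro X hX hX0
    filter_upwards [(hX.contMDiffAt_inner hX).self_of_nhds.continuousAt.eventually_ne
      (inner_self_ne_zero.2 hX0)] with y hy using inner_self_ne_zero.1 hy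
  refine ⟨![e₀, e₁], ⟨?_, ?_, by simp [hE]⟩, ?_⟩
  · intro i
    fin_cases i
    exacts [h0, h1]
  · filter_upwards [hne hA hA0, hne hB hB0] with y hy hy'
    have k0 : (inner ℝ (e₀ y) (e₀ y) : ℝ) = 1 := inner_normalizedField_self hy
    have k1 : (inner ℝ (e₁ y) (e₁ y) : ℝ) = 1 := inner_normalizedField_self hy'
    have k2 : (inner ℝ (e₁ y) (e₀ y) : ℝ) = 0 := by
      simp only [he₁, normalizedField, inner_smul_left, RCLike.conj_to_real]
      rw [hBdef]
      simp only [inner_sub_left, inner_smul_left, RCLike.conj_to_real, k0, mul_one, sub_self,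
        mul_zero]
    have k3 : (inner ℝ (e₀ y) (e₁ y) : ℝ) = 0 := by rw [real_inner_comm, k2]
    rw [orthonormal_iff_ite]
    intro i j
    fin_cases i <;> fin_cases j
    exacts [k0, k3, k2, k1]
  · intro i
    fin_cases i
    exacts [h0x, h1x]

variable [FiniteDimensional ℝ E]

namespace IsOrthonormalFrameNear

/-- The Christoffel symbols are skew in their last two indices, so in the frame formula the
derivative terms change sign and the two quadratic products trade places. -/
theorem curvature₄_swap_right {ι : Type*} [Fintype ι] {e : ι → (x : M) → TangentSpace I x}
    (h : IsOrthonormalFrameNear e x) (i j k l : ι) :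
    curvature₄ (e i) (e j) (e k) (e l) x = -curvature₄ (e i) (e j) (e l) (e k) x := by
  have h1 : ∀ i k l, mvfderiv I (christoffel e i l k) x = -mvfderiv I (christoffel e i k l) x := by
    intro i k l
    rw [← mvfderiv_neg]
    congr 1
    funext y
    exact christoffel_swap e i l k y
  rw [h.curvature₄_eq, h.curvature₄_eq, h1 j k l, h1 i k l, neg_add, ← Finset.sum_neg_distrib]
  congr 1
  · simp only [neg_apply]
    ring
  · refine Finset.sum_congr rfl fun m _ ↦ ?_
    rw [christoffel_swap e j l m, christoffel_swap e i m k, christoffel_swap e i l m,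
      christoffel_swap e j m k, christoffel_swap e m l k]
    ring

/-- The sectional curvature of a surface in an orthonormal frame. -/
theorem sectionalCurvature_eq [I.Boundaryless] {e : Fin 2 → (x : M) → TangentSpace I x}
    (h : IsOrthonormalFrameNear e x) {u v : TangentSpace I x}
    (huv : LinearIndependent ℝ ![u, v]) :
    sectionalCurvature u v = curvature₄ (e 0) (e 1) (e 0) (e 1) x := by
  set a := (inner ℝ u (e 0 x) : ℝ)
  set b := (inner ℝ u (e 1 x) : ℝ)
  set c := (inner ℝ v (e 0 x) : ℝ)
  set d := (inner ℝ v (e 1 x) : ℝ)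
  have hu : u = a • e 0 x + b • e 1 x := by
    rw [← h.sum_inner_smul u, Fin.sum_univ_two]
  have hv : v = c • e 0 x + d • e 1 x := by
    rw [← h.sum_inner_smul v, Fin.sum_univ_two]
  -- The determinant of the change of basis from the frame to `u`, `v`. Its square appears both in
  -- the curvature numerator and as the Gram determinant in the denominator.
  have hdet : a * d - b * c ≠ 0 := by
    intro h0
    have h1 : d • u + (-b) • v = (0 : TangentSpace I x) := by
      rw [← zero_smul ℝ (e 0 x), ← h0, hu, hv]
      module
    have h2 : (-c) • u + a • v = (0 : TangentSpace I x) := by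
      rw [← zero_smul ℝ (e 1 x), ← h0, hu, hv]
      module
    have h3 := LinearIndependent.pair_iff.1 huv _ _ h1
    have h4 := LinearIndependent.pair_iff.1 huv _ _ h2
    have hu0 : u = 0 := by
      rw [hu, h4.2, neg_eq_zero.1 h3.2]
      simp
    exact huv.ne_zero 0 hu0
  have hB : ∀ W, SmoothNear W x →
      curvature (FiberBundle.extend E u) (FiberBundle.extend E v) W x =
        (a * d - b * c) • curvature (e 0) (e 1) W x := by
    intro W hW
    -- By tensoriality the curvature on the chosen extensions of `u`, `v` is an alternating bilinear
    -- form in `u`, `v`, so it scales by the determinant.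
    set B := TensorialAt.mkHom₂ (fun X Y ↦ curvature X Y W x) x
      (fun Y _ ↦ h.curvature_tensorial Y hW) (fun X _ ↦ h.curvature_tensorial_right X hW)
    have hBe : ∀ i j, B (e i x) (e j x) = curvature (e i) (e j) W x := fun i j ↦
      TensorialAt.mkHom₂_apply (Φ := fun X Y ↦ curvature X Y W x) _ _
        (h.mdifferentiableAt i) (h.mdifferentiableAt j)
    have hself : ∀ i, curvature (e i) (e i) W x = 0 := by
      intro i
      have h2 : (2 : ℝ) • curvature (e i) (e i) W x = 0 := by
        rw [two_smul]
        exact eq_neg_iff_add_eq_zero.1 (curvature_swap (e i) (e i) W x)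
      exact (smul_eq_zero.1 h2).resolve_left two_ne_zero
    have h1 : B u v = curvature (FiberBundle.extend E u) (FiberBundle.extend E v) W x :=
      TensorialAt.mkHom₂_apply_eq_extend (Φ := fun X Y ↦ curvature X Y W x) _ _ u v
    rw [← h1, hu, hv]
    simp only [map_add, map_smul, add_apply, smul_apply, hBe, hself, curvature_swap (e 1) (e 0)]
    module
  have hR : ∀ k l, (inner ℝ (curvature (e 0) (e 1) (e l) x) (e k x) : ℝ) =
      curvature₄ (e 0) (e 1) (e k) (e l) x := fun k l ↦ rfl
  have h00 : curvature₄ (e 0) (e 1) (e 0) (e 0) x = 0 :=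
    self_eq_neg.1 (h.curvature₄_swap_right 0 1 0 0)
  have h11 : curvature₄ (e 0) (e 1) (e 1) (e 1) x = 0 :=
    self_eq_neg.1 (h.curvature₄_swap_right 0 1 1 1)
  have h10 := h.curvature₄_swap_right 0 1 1 0
  have hnum : curvature₄ (FiberBundle.extend E u) (FiberBundle.extend E v)
      (FiberBundle.extend E u) (FiberBundle.extend E v) x =
      (a * d - b * c) ^ 2 * curvature₄ (e 0) (e 1) (e 0) (e 1) x := by
    rw [curvature₄, hB _ (smoothNear_extend v), h.curvature_eq_sum (h.mdifferentiableAt 0)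
      (h.mdifferentiableAt 1) (smoothNear_extend v), FiberBundle.extend_apply_self,
      FiberBundle.extend_apply_self, Fin.sum_univ_two]
    conv_lhs => rw [hu]
    simp only [inner_smul_left, inner_add_left, inner_add_right, inner_smul_right, hR, h00, h11,
      h10, RCLike.conj_to_real]
    ring
  have e00 : (inner ℝ (e 0 x) (e 0 x) : ℝ) = 1 := by simpa using h.inner_eq 0 0
  have e11 : (inner ℝ (e 1 x) (e 1 x) : ℝ) = 1 := by simpa using h.inner_eq 1 1
  have e01 : (inner ℝ (e 0 x) (e 1 x) : ℝ) = 0 := by simpa using h.inner_eq 0 1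
  have e10 : (inner ℝ (e 1 x) (e 0 x) : ℝ) = 0 := by simpa using h.inner_eq 1 0
  have hden : (inner ℝ u u * inner ℝ v v - inner ℝ u v ^ 2 : ℝ) = (a * d - b * c) ^ 2 := by
    rw [hu, hv]
    simp only [inner_smul_left, inner_add_left, inner_add_right, inner_smul_right, e00, e11, e01,
      e10, RCLike.conj_to_real]
    ring
  rw [sectionalCurvature, hnum, hden, mul_div_cancel_left₀ _ (pow_ne_zero 2 hdet)]

/-- The curvature of a surface in terms of the structure functions of an orthonormal frame. -/
theorem curvature₄_fin_two {e : Fin 2 → (x : M) → TangentSpace I x}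
    (h : IsOrthonormalFrameNear e x) :
    curvature₄ (e 0) (e 1) (e 0) (e 1) x =
      mvfderiv I (structureFun e 0 1 1) x (e 0 x) - mvfderiv I (structureFun e 0 1 0) x (e 1 x) -
        structureFun e 0 1 0 x ^ 2 - structureFun e 0 1 1 x ^ 2 := by
  rw [h.curvature₄_eq, h.mvfderiv_christoffel, h.mvfderiv_christoffel]
  simp only [Fin.sum_univ_two, christoffel, structureFun_self, structureFun_swap e 1 0,
    mvfderiv_neg, mvfderiv_zero, Pi.neg_apply, Pi.zero_apply, smul_apply, sub_apply, neg_apply,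
    zero_apply, smul_eq_mul]
  ring

end IsOrthonormalFrameNear

end Surfaces

end

end HarmonicSubmersion

namespace HarmonicSubmersion

open VectorField Filter
open scoped Topology

noncomputable section

/-! ### The pull-back connection and the tension field. -/

section Tension

variable {E : Type*} [NormedAddCommGroup E] [NormedSpace ℝ E]
  {H : Type*} [TopologicalSpace H] {I : ModelWithCorners ℝ E H}
  {M : Type*} [TopologicalSpace M] [ChartedSpace H M]
  {F : Type*} [NormedAddCommGroup F] [NormedSpace ℝ F]
  {G : Type*} [TopologicalSpace G] {J : ModelWithCorners ℝ F G}
  {N : Type*} [TopologicalSpace N] [ChartedSpace G N]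
  {φ : M → N} {x : M}

theorem mvfderiv_congr {f g : M → F} (h : f =ᶠ[𝓝 x] g) : mvfderiv I f x = mvfderiv I g x := by
  ext v
  exact congrArg (fun L : TangentSpace I x →L[ℝ] F ↦ L v) h.mfderiv_eq

/-- The section dφ(Y) along φ is the composite of Y with the tangent map of φ, which is of class C¹.
-/
theorem mdifferentiableAt_mfderiv_apply [IsManifold I ∞ M] [IsManifold J ∞ N] (hφ : ContMDiff I J ∞ φ) {Y : (x : M) → TangentSpace I x}
    (hY : MDiffAt (T% Y) x) :
    MDifferentiableAt I J.tangent
      (fun x ↦ (⟨φ x, mfderiv I J φ x (Y x)⟩ : TangentBundle J N)) x := by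
  have h1 : ContMDiff I.tangent J.tangent 1 (tangentMap I J φ) :=
    hφ.contMDiff_tangentMap (by rw [one_add_one_eq_two]; exact ENat.LEInfty.out)
  exact ((h1.mdifferentiable (by simp)) ⟨x, Y x⟩).comp x hY

variable [FiniteDimensional ℝ F] [IsManifold J ∞ N]

variable (I) in
/-- The coefficients of a section along `φ` in the local frame used for the pull-back connection
are differentiable. -/
theorem mdifferentiableAt_localFrameCoeff_along {s : (x : M) → TangentSpace J (φ x)}
    (hs : MDifferentiableAt I J.tangent (fun x ↦ (⟨φ x, s x⟩ : TangentBundle J N)) x)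
    (a : Fin (Module.finrank ℝ F)) :
    MDiffAt (fun x' ↦ (trivializationAt F (TangentSpace J : N → Type _) (φ x)).localFrameCoeff J
      (Module.finBasis ℝ F) a (φ x') (s x')) x := by
  have h1 := (mdifferentiableAt_totalSpace J _).1 hs
  have h2 : MDiffAt (fun x' ↦ (Module.finBasis ℝ F).coord a
      (trivializationAt F (TangentSpace J : N → Type _) (φ x) ⟨φ x', s x'⟩).2) x :=
    ((((Module.finBasis ℝ F).coord a).toContinuousLinearMap.differentiable
      _).mdifferentiableAt).comp x h1.2
  refine h2.congr_of_eventuallyEq ?_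
  have hopen := (trivializationAt F (TangentSpace J : N → Type _) (φ x)).open_baseSet.mem_nhds
    (FiberBundle.mem_baseSet_trivializationAt' (φ x))
  filter_upwards [h1.1.continuousAt.eventually hopen] with y hy
  have h3 := (trivializationAt F (TangentSpace J : N → Type _) (φ x)).localFrameCoeff_eq_coeff
    (I := J) (b := Module.finBasis ℝ F) (s := FiberBundle.extend F (s y)) hy (i := a)
  simp only [FiberBundle.extend_apply_self] at h3
  exact h3

theorem sum_localFrameCoeff_smul (y : N) (v : TangentSpace J y) :
    ∑ a, (trivializationAt F (TangentSpace J : N → Type _) y).localFrameCoeff J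
      (Module.finBasis ℝ F) a y v •
      (trivializationAt F (TangentSpace J : N → Type _) y).localFrame (Module.finBasis ℝ F) a y =
      v := by
  have h3 := (trivializationAt F (TangentSpace J : N → Type _) y).eq_sum_localFrameCoeff_smul
    (I := J) (b := Module.finBasis ℝ F) (s := FiberBundle.extend F v)
    (FiberBundle.mem_baseSet_trivializationAt' y)
  simp only [FiberBundle.extend_apply_self] at h3
  exact h3.symm

variable [RiemannianBundle (fun y : N ↦ TangentSpace J y)]
  [IsContMDiffRiemannianBundle J ∞ F (fun y : N ↦ TangentSpace J y)]

theorem pullbackNabla_congr {s s' : (x : M) → TangentSpace J (φ x)}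
    (h : ∀ᶠ y in 𝓝 x, s y = s' y) (v : TangentSpace I x) :
    pullbackNabla I φ s x v = pullbackNabla I φ s' x v := by
  simp only [pullbackNabla, h.self_of_nhds]
  refine Finset.sum_congr rfl fun a _ ↦ ?_
  congr 2
  have h1 : (fun x' ↦ (trivializationAt F (TangentSpace J : N → Type _) (φ x)).localFrameCoeff J
      (Module.finBasis ℝ F) a (φ x') (s x')) =ᶠ[𝓝 x]
      (fun x' ↦ (trivializationAt F (TangentSpace J : N → Type _) (φ x)).localFrameCoeff J
      (Module.finBasis ℝ F) a (φ x') (s' x')) := by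
    filter_upwards [h] with y hy
    rw [hy]
  rw [mvfderiv_congr h1]

theorem pullbackNabla_add {s s' : (x : M) → TangentSpace J (φ x)}
    (hs : MDifferentiableAt I J.tangent (fun x ↦ (⟨φ x, s x⟩ : TangentBundle J N)) x)
    (hs' : MDifferentiableAt I J.tangent (fun x ↦ (⟨φ x, s' x⟩ : TangentBundle J N)) x)
    (v : TangentSpace I x) :
    pullbackNabla I φ (fun y ↦ s y + s' y) x v =
      pullbackNabla I φ s x v + pullbackNabla I φ s' x v := by
  simp only [pullbackNabla, map_add]
  rw [← Finset.sum_add_distrib]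
  refine Finset.sum_congr rfl fun a _ ↦ ?_
  rw [mvfderiv_fun_add (mdifferentiableAt_localFrameCoeff_along I hs a)
    (mdifferentiableAt_localFrameCoeff_along I hs' a), add_apply]
  module

theorem pullbackNabla_smul {s : (x : M) → TangentSpace J (φ x)} {f : M → ℝ}
    (hf : MDiffAt f x)
    (hs : MDifferentiableAt I J.tangent (fun x ↦ (⟨φ x, s x⟩ : TangentBundle J N)) x)
    (v : TangentSpace I x) :
    pullbackNabla I φ (fun y ↦ f y • s y) x v =
      f x • pullbackNabla I φ s x v + mvfderiv I f x v • s x := by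
  conv_rhs => rw [← sum_localFrameCoeff_smul (φ x) (s x)]
  simp only [pullbackNabla, map_smul]
  rw [Finset.smul_sum, Finset.smul_sum, ← Finset.sum_add_distrib]
  refine Finset.sum_congr rfl fun a _ ↦ ?_
  simp only [smul_eq_mul]
  rw [mvfderiv_fun_mul hf (mdifferentiableAt_localFrameCoeff_along I hs a), add_apply, smul_apply,
    smul_apply, smul_eq_mul, smul_eq_mul]
  module

/-- The pull-back connection on sections of the form `V ∘ φ`. -/
theorem pullbackNabla_comp (hφ : MDiffAt φ x) {V : (y : N) → TangentSpace J y}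
    (hV : MDiffAt (T% V) (φ x)) (v : TangentSpace I x) :
    pullbackNabla I φ (fun y ↦ V (φ y)) x v = leviCivita J N V (φ x) (mfderiv I J φ x v) := by
  set t := trivializationAt F (TangentSpace J : N → Type _) (φ x) with ht
  have hbase : φ x ∈ t.baseSet := FiberBundle.mem_baseSet_trivializationAt' (φ x)
  set b := Module.finBasis ℝ F with hb
  have hc : ∀ a, MDiffAt (fun y ↦ t.localFrameCoeff J b a y (V y)) (φ x) := fun a ↦
    mdifferentiableAt_localFrameCoeff b hbase hV a
  have hX : ∀ a, MDiffAt (T% (t.localFrame b a)) (φ x) := fun a ↦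
    (contMDiffAt_localFrame_of_mem 1 _ b a hbase).mdifferentiableAt (by simp)
  have h1 : leviCivita J N V (φ x) (mfderiv I J φ x v) = _ :=
    (congrArg (· (mfderiv I J φ x v)) (leviCivita_congr
      (mdifferentiableAt_sum_smul (s := Finset.univ) hc hX)
      (t.eventually_eq_localFrame_sum_coeff_smul (s := V) b hbase))).trans
    (leviCivita_sum_smul hc hX _)
  rw [h1]
  simp only [pullbackNabla]
  refine Finset.sum_congr rfl fun a _ ↦ ?_
  rw [add_comm]
  congr 2
  exact mvfderiv_comp_apply x (hc a) hφ v

variable [IsManifold I ∞ M]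

variable [FiniteDimensional ℝ E] [RiemannianBundle (fun x : M ↦ TangentSpace I x)]
  [IsContMDiffRiemannianBundle I ∞ E (fun x : M ↦ TangentSpace I x)]

theorem secondFundamentalForm_tensorial_left (Y : (x : M) → TangentSpace I x) :
    TensorialAt I E (fun X ↦ secondFundamentalForm I J φ X Y x) x where
  smul {f X} _ _ := by
    simp only [secondFundamentalForm, pullbackNabla, nabla, Pi.smul_apply', map_smul, smul_sub,
      Finset.smul_sum]
    congr 1
    refine Finset.sum_congr rfl fun a _ ↦ ?_
    simp only [smul_eq_mul]
    module
  add {X X'} _ _ := by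
    simp only [secondFundamentalForm, pullbackNabla, nabla, Pi.add_apply, map_add, add_smul,
      smul_add, Finset.sum_add_distrib]
    abel

/-- Both connections obey the Leibniz rule, so the terms X(f)dφ(Y) cancel in the difference. -/
theorem secondFundamentalForm_tensorial_right (hφ : ContMDiff I J ∞ φ)
    (X : (x : M) → TangentSpace I x) :
    TensorialAt I E (fun Y ↦ secondFundamentalForm I J φ X Y x) x where
  smul {f Y} hf hY := by
    have h1 := pullbackNabla_smul hf (mdifferentiableAt_mfderiv_apply hφ hY) (X x)
    have h2 : nabla X (f • Y) x = f x • nabla X Y x + mvfderiv I f x (X x) • Y x :=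
      leviCivita_smul hf hY (X x)
    simp only [secondFundamentalForm, Pi.smul_apply', map_smul]
    rw [h1, h2, map_add, map_smul, map_smul]
    module
  add {Y Y'} hY hY' := by
    have h1 := pullbackNabla_add (mdifferentiableAt_mfderiv_apply hφ hY)
      (mdifferentiableAt_mfderiv_apply hφ hY') (X x)
    have h2 : nabla X (Y + Y') x = nabla X Y x + nabla X Y' x := leviCivita_add hY hY' (X x)
    simp only [secondFundamentalForm, Pi.add_apply, map_add]
    rw [h1, h2, map_add]
    abel

/-- The tension field is the trace of the second fundamental form in any orthonormal frame. -/
theorem tensionField_eq_sum {ι : Type*} [Fintype ι] {e : ι → (x : M) → TangentSpace I x}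
    (hφ : ContMDiff I J ∞ φ) (h : IsOrthonormalFrameNear e x) :
    tensionField I J φ x = ∑ i, secondFundamentalForm I J φ (e i) (e i) x := by
  classical
  set B := TensorialAt.mkHom₂ (fun X Y ↦ secondFundamentalForm I J φ X Y x) x
    (fun Y _ ↦ secondFundamentalForm_tensorial_left Y)
    (fun X _ ↦ secondFundamentalForm_tensorial_right hφ X)
  have h1 : ∀ i, secondFundamentalForm I J φ (e i) (e i) x = B (e i x) (e i x) := fun i ↦
    (TensorialAt.mkHom₂_apply (Φ := fun X Y ↦ secondFundamentalForm I J φ X Y x) _ _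
      (h.mdifferentiableAt i) (h.mdifferentiableAt i)).symm
  set b := stdOrthonormalBasis ℝ (TangentSpace I x)
  -- The bilinear map `B` is evaluated through `FiberBundle.extend`, exactly the extensions used in
  -- `tensionField`.
  have h2 : tensionField I J φ x = ∑ k, B (b k) (b k) := rfl
  have h3 : ∀ k, B (b k) (b k) = ∑ i, ∑ j,
      ((inner ℝ (e i x) (b k) : ℝ) * inner ℝ (b k) (e j x)) • B (e i x) (e j x) := by
    intro k
    conv_lhs => rw [← h.sum_inner_smul (b k)]
    simp only [map_sum, map_smul, sum_apply, smul_apply, Finset.smul_sum, smul_smul]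
    rw [Finset.sum_comm]
    refine Finset.sum_congr rfl fun i _ ↦ Finset.sum_congr rfl fun j _ ↦ ?_
    rw [real_inner_comm (b k) (e i x), mul_comm]
  rw [h2]
  simp only [h3, h1]
  rw [Finset.sum_comm]
  refine Finset.sum_congr rfl fun i _ ↦ ?_
  rw [Finset.sum_comm]
  -- Parseval: summing ⟨eᵢ,bₖ⟩⟨bₖ,eⱼ⟩ over k leaves ⟨eᵢ,eⱼ⟩ = δᵢⱼ.
  simp only [← Finset.sum_smul, b.sum_inner_mul_inner, h.inner_eq]
  simp

end Tension

end

end HarmonicSubmersion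

namespace HarmonicSubmersion

open VectorField Filter
open scoped Topology

noncomputable section

set_option linter.unusedSectionVars false

/-! ### Riemannian submersions: natural frames, horizontal lifts, basic frames. -/

section Submersion

variable {E : Type*} [NormedAddCommGroup E] [NormedSpace ℝ E]
  {H : Type*} [TopologicalSpace H] {I : ModelWithCorners ℝ E H}
  {M : Type*} [TopologicalSpace M] [ChartedSpace H M] [IsManifold I ∞ M]
  [RiemannianBundle (fun x : M ↦ TangentSpace I x)]
  {F : Type*} [NormedAddCommGroup F] [NormedSpace ℝ F]
  {G : Type*} [TopologicalSpace G] {J : ModelWithCorners ℝ F G}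
  {N : Type*} [TopologicalSpace N] [ChartedSpace G N] [IsManifold J ∞ N]
  [RiemannianBundle (fun y : N ↦ TangentSpace J y)]
  {φ : M → N} {x : M}

/-- The inner product of a horizontal vector with any other vector is preserved by a Riemannian
submersion. -/
theorem IsRiemannianSubmersion.inner_eq [FiniteDimensional ℝ E]
    (hφ : IsRiemannianSubmersion I J φ) {u : TangentSpace I x}
    (hu : IsHorizontal I J φ u) (v : TangentSpace I x) :
    (inner ℝ u v : ℝ) = inner ℝ (mfderiv I J φ x u) (mfderiv I J φ x v) := by
  set K : Submodule ℝ (TangentSpace I x) := (mfderiv I J φ x).toLinearMap.ker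
  obtain ⟨k, hk, w, hw, rfl⟩ := K.exists_add_mem_mem_orthogonal v
  have hk' : mfderiv I J φ x k = 0 := hk
  have hw' : IsHorizontal I J φ w := fun z hz ↦ by
    rw [real_inner_comm]
    exact (K.mem_orthogonal w).1 hw z hz
  rw [inner_add_right, hu k hk', zero_add, map_add, hk', zero_add, hφ.isometric x u w hu hw']

theorem isHorizontal_sum {κ : Type*} {s : Finset κ} {v : κ → TangentSpace I x}
    (hv : ∀ i, IsHorizontal I J φ (v i)) (f : κ → ℝ) :
    IsHorizontal I J φ (∑ i ∈ s, f i • v i) := fun w hw ↦ by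
  rw [sum_inner]
  refine Finset.sum_eq_zero fun i _ ↦ ?_
  rw [inner_smul_left, hv i w hw, mul_zero]

/-- An orthonormal frame in a neighbourhood of `x` which is natural for the map `φ` with
one-dimensional fibres: the last vector is vertical and the other ones are horizontal. -/
structure IsNaturalFrameNear (J : ModelWithCorners ℝ F G) (φ : M → N)
    (e : Fin 3 → (x : M) → TangentSpace I x) (x : M) : Prop
    extends IsOrthonormalFrameNear e x where
  horizontal : ∀ᶠ y in 𝓝 x, ∀ a : Fin 2, IsHorizontal I J φ (e a.castSucc y)
  vertical : ∀ᶠ y in 𝓝 x, mfderiv I J φ y (e 2 y) = 0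

/-- The horizontal lift of the vector field `V` with respect to a natural frame. -/
def horizontalLift (J : ModelWithCorners ℝ F G) [RiemannianBundle (fun y : N ↦ TangentSpace J y)]
    (φ : M → N) (e : Fin 3 → (x : M) → TangentSpace I x)
    (V : (y : N) → TangentSpace J y) (x : M) : TangentSpace I x :=
  ∑ a : Fin 2, (inner ℝ (mfderiv I J φ x (e a.castSucc x)) (V (φ x)) : ℝ) • e a.castSucc x

namespace IsNaturalFrameNear

variable {e : Fin 3 → (x : M) → TangentSpace I x}

theorem eventually_natural (h : IsNaturalFrameNear J φ e x) :
    ∀ᶠ y in 𝓝 x, IsNaturalFrameNear J φ e y := by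
  filter_upwards [h.eventually, h.horizontal.eventually_nhds, h.vertical.eventually_nhds]
    with y h1 h2 h3 using ⟨h1, h2, h3⟩

theorem isHorizontal (h : IsNaturalFrameNear J φ e x) (a : Fin 2) :
    IsHorizontal I J φ (e a.castSucc x) :=
  h.horizontal.self_of_nhds a

theorem mfderiv_vertical (h : IsNaturalFrameNear J φ e x) : mfderiv I J φ x (e 2 x) = 0 :=
  h.vertical.self_of_nhds

theorem inner_mfderiv (h : IsNaturalFrameNear J φ e x) (hφ : IsRiemannianSubmersion I J φ)
    (a b : Fin 2) :
    (inner ℝ (mfderiv I J φ x (e a.castSucc x)) (mfderiv I J φ x (e b.castSucc x)) : ℝ) =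
      if a = b then 1 else 0 := by
  rw [hφ.isometric x _ _ (h.isHorizontal a) (h.isHorizontal b), h.inner_eq]
  simp

theorem orthonormal_mfderiv (h : IsNaturalFrameNear J φ e x) (hφ : IsRiemannianSubmersion I J φ) :
    Orthonormal ℝ fun a : Fin 2 ↦ mfderiv I J φ x (e a.castSucc x) :=
  orthonormal_iff_ite.2 (h.inner_mfderiv hφ)

/-- As the base has dimension 2, the images of the two horizontal frame vectors form an orthonormal
basis downstairs, and the lift copies the components of V in it. -/
theorem mfderiv_horizontalLift [FiniteDimensional ℝ F] (h : IsNaturalFrameNear J φ e x)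
    (hφ : IsRiemannianSubmersion I J φ) (hF : Module.finrank ℝ F = 2)
    (V : (y : N) → TangentSpace J y) :
    mfderiv I J φ x (horizontalLift J φ e V x) = V (φ x) := by
  have ho := h.orthonormal_mfderiv hφ
  let b : OrthonormalBasis (Fin 2) ℝ (TangentSpace J (φ x)) := OrthonormalBasis.mk ho
    (ho.linearIndependent.span_eq_top_of_card_eq_finrank' (hF.symm ▸ rfl)).ge
  have hb : ∀ a, b a = mfderiv I J φ x (e a.castSucc x) := fun a ↦ by simp [b]
  conv_rhs => rw [← b.sum_repr' (V (φ x))]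
  simp only [horizontalLift, map_sum, map_smul, hb]

theorem isHorizontal_horizontalLift (h : IsNaturalFrameNear J φ e x)
    (V : (y : N) → TangentSpace J y) : IsHorizontal I J φ (horizontalLift J φ e V x) :=
  isHorizontal_sum h.isHorizontal _

variable [IsContMDiffRiemannianBundle J ∞ F (fun y : N ↦ TangentSpace J y)]

theorem smoothNear_horizontalLift (h : IsNaturalFrameNear J φ e x)
    (hφ : IsRiemannianSubmersion I J φ) {V : (y : N) → TangentSpace J y}
    (hV : SmoothNear V (φ x)) : SmoothNear (horizontalLift J φ e V) x := by
  refine SmoothNear.sum_smul (fun a ↦ ?_) fun a ↦ h.smooth a.castSucc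
  filter_upwards [h.smooth a.castSucc, hφ.contMDiff.continuous.continuousAt.eventually hV]
    with y h1 h2
  refine ContMDiffAt.inner_bundle (IB := J) (F := F) (E := fun y : N ↦ TangentSpace J y) (b := φ)
    ?_ (h2.comp y hφ.contMDiff.contMDiffAt)
  have h3 : ContMDiff I.tangent J.tangent ∞ (tangentMap I J φ) :=
    hφ.contMDiff.contMDiff_tangentMap le_rfl
  exact (h3.contMDiffAt (x := ⟨y, e a.castSucc y⟩)).comp y h1

end IsNaturalFrameNear

/-- A natural frame whose horizontal vector fields are related to an orthonormal frame of the
base. -/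
structure IsBasicFrameNear (φ : M → N) (ε : Fin 3 → (x : M) → TangentSpace I x)
    (e' : Fin 2 → (y : N) → TangentSpace J y) (x : M) : Prop
    extends IsNaturalFrameNear J φ ε x where
  base : IsOrthonormalFrameNear e' (φ x)
  related : ∀ᶠ y in 𝓝 x, ∀ a : Fin 2, mfderiv I J φ y (ε a.castSucc y) = e' a (φ y)

variable [IsContMDiffRiemannianBundle J ∞ F (fun y : N ↦ TangentSpace J y)]

/-- At every point a natural frame agrees with a basic frame. -/
theorem IsNaturalFrameNear.exists_isBasicFrameNear [FiniteDimensional ℝ E] [FiniteDimensional ℝ F]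
    {e : Fin 3 → (x : M) → TangentSpace I x} (h : IsNaturalFrameNear J φ e x)
    (hφ : IsRiemannianSubmersion I J φ) (hF : Module.finrank ℝ F = 2) :
    ∃ (ε : Fin 3 → (x : M) → TangentSpace I x) (e' : Fin 2 → (y : N) → TangentSpace J y),
      IsBasicFrameNear φ ε e' x ∧ (∀ i, ε i x = e i x) ∧ ε 2 = e 2 := by
  -- Extend the images dφ(eₐ) at the single point `x` to a frame of N and lift it back; this makes
  -- the new frame agree with `e` at `x`.
  obtain ⟨e', he', hv⟩ := exists_isOrthonormalFrameNear hF (h.orthonormal_mfderiv hφ)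
  let ε : Fin 3 → (x : M) → TangentSpace I x :=
    Fin.snoc (α := fun _ ↦ (x : M) → TangentSpace I x) (fun a ↦ horizontalLift J φ e (e' a)) (e 2)
  have hε : ∀ a : Fin 2, ε a.castSucc = horizontalLift J φ e (e' a) := fun a ↦
    Fin.snoc_castSucc (α := fun _ ↦ (x : M) → TangentSpace I x) ..
  have hε2 : ε 2 = e 2 := Fin.snoc_last (α := fun _ ↦ (x : M) → TangentSpace I x) ..
  have hrel : ∀ᶠ y in 𝓝 x, ∀ a : Fin 2, mfderiv I J φ y (ε a.castSucc y) = e' a (φ y) := by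
    filter_upwards [h.eventually_natural] with y hy a
    rw [hε]
    exact hy.mfderiv_horizontalLift hφ hF _
  have hhor : ∀ᶠ y in 𝓝 x, ∀ a : Fin 2, IsHorizontal I J φ (ε a.castSucc y) := by
    filter_upwards [h.eventually_natural] with y hy a
    rw [hε]
    exact hy.isHorizontal_horizontalLift _
  have hver : ∀ᶠ y in 𝓝 x, mfderiv I J φ y (ε 2 y) = 0 := by
    rw [hε2]
    exact h.vertical
  refine ⟨ε, e', ⟨⟨⟨?_, ?_, h.card_eq⟩, hhor, hver⟩, he', hrel⟩, ?_, hε2⟩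
  · refine Fin.lastCases ?_ fun a ↦ ?_
    · exact (congrArg (fun X ↦ SmoothNear X x) hε2).mpr (h.smooth 2)
    · rw [hε]
      exact h.smoothNear_horizontalLift hφ (he'.smooth a)
  · filter_upwards [hhor, hver, hrel, h.eventually,
      hφ.contMDiff.continuous.continuousAt.eventually he'.eventually] with y h1 h2 h3 h4 h5
    rw [orthonormal_iff_ite]
    have h22 : (inner ℝ (ε 2 y) (ε 2 y) : ℝ) = 1 := by
      rw [hε2]
      simpa using h4.inner_eq 2 2
    have ha2 : ∀ a : Fin 2, (inner ℝ (ε a.castSucc y) (ε 2 y) : ℝ) = 0 := fun a ↦ h1 a _ h2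
    refine Fin.lastCases (Fin.lastCases ?_ fun b ↦ ?_) fun a ↦ Fin.lastCases ?_ fun b ↦ ?_
    · simpa using h22
    · rw [if_neg (Fin.castSucc_lt_last b).ne', real_inner_comm]
      exact ha2 b
    · rw [if_neg (Fin.castSucc_lt_last a).ne]
      exact ha2 a
    · rw [hφ.inner_eq (h1 a), h3, h3, h5.inner_eq]
      simp
  · refine Fin.lastCases ?_ fun a ↦ ?_
    · exact congrFun hε2 x
    · rw [hε, horizontalLift, hv]
      simp only [h.inner_mfderiv hφ]
      simp

end Submersion

end

end HarmonicSubmersion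

namespace HarmonicSubmersion

open VectorField Filter
open scoped Topology

noncomputable section

set_option linter.unusedSectionVars false

/-! ### Brackets in basic and natural frames; the tension field through κ₁, κ₂. -/

section BasicFrames

variable {E : Type*} [NormedAddCommGroup E] [NormedSpace ℝ E] [FiniteDimensional ℝ E]
  {H : Type*} [TopologicalSpace H] {I : ModelWithCorners ℝ E H} [I.Boundaryless]
  {M : Type*} [TopologicalSpace M] [ChartedSpace H M] [IsManifold I ∞ M]
  [RiemannianBundle (fun x : M ↦ TangentSpace I x)]
  {F : Type*} [NormedAddCommGroup F] [NormedSpace ℝ F] [FiniteDimensional ℝ F]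
  {G : Type*} [TopologicalSpace G] {J : ModelWithCorners ℝ F G} [J.Boundaryless]
  {N : Type*} [TopologicalSpace N] [ChartedSpace G N] [IsManifold J ∞ N]
  [RiemannianBundle (fun y : N ↦ TangentSpace J y)]
  {φ : M → N} {x : M} {ε : Fin 3 → (x : M) → TangentSpace I x}
  {e' : Fin 2 → (y : N) → TangentSpace J y}

namespace IsBasicFrameNear

theorem eventually_basic (h : IsBasicFrameNear φ ε e' x) (hφ : IsRiemannianSubmersion I J φ) :
    ∀ᶠ y in 𝓝 x, IsBasicFrameNear φ ε e' y := by
  filter_upwards [h.eventually_natural, h.related.eventually_nhds,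
    hφ.contMDiff.continuous.continuousAt.eventually h.base.eventually] with y h1 h2 h3
    using ⟨h1, h3, h2⟩

theorem structureFun_eq (h : IsBasicFrameNear φ ε e' x) (hφ : IsRiemannianSubmersion I J φ)
    (a b c : Fin 2) :
    structureFun ε a.castSucc b.castSucc c.castSucc x = structureFun e' a b c (φ x) := by
  have : CompleteSpace E := FiniteDimensional.complete ℝ E
  have : CompleteSpace F := FiniteDimensional.complete ℝ F
  have hr := h.related
  have h1 := mfderiv_mlieBracket_of_related (hφ.contMDiff.contMDiffAt.of_le ENat.LEInfty.out)
    (h.mdifferentiableAt a.castSucc) (h.mdifferentiableAt b.castSucc)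
    (h.base.mdifferentiableAt a) (h.base.mdifferentiableAt b)
    (hr.mono fun y hy ↦ hy a) (hr.mono fun y hy ↦ hy b)
  rw [structureFun, structureFun, real_inner_comm, hφ.inner_eq (h.isHorizontal c), h1,
    hr.self_of_nhds c, real_inner_comm]

/-- The vertical field is related to the zero field, so its bracket with a basic field is related to
zero, that is, vertical. -/
theorem structureFun_vertical (h : IsBasicFrameNear φ ε e' x) (hφ : IsRiemannianSubmersion I J φ)
    (a b : Fin 2) : structureFun ε a.castSucc 2 b.castSucc x = 0 := by
  have : CompleteSpace E := FiniteDimensional.complete ℝ E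
  have : CompleteSpace F := FiniteDimensional.complete ℝ F
  have h1 := mfderiv_mlieBracket_of_related (hφ.contMDiff.contMDiffAt.of_le ENat.LEInfty.out)
    (h.mdifferentiableAt a.castSucc) (h.mdifferentiableAt 2)
    (h.base.mdifferentiableAt a) (W := 0) (mdifferentiable_zeroSection _ _ _)
    (h.related.mono fun y hy ↦ hy a) h.vertical
  rw [structureFun, real_inner_comm, hφ.inner_eq (h.isHorizontal b), h1, mlieBracket_zero_right]
  exact inner_zero_right _

variable [IsContMDiffRiemannianBundle I ∞ E (fun x : M ↦ TangentSpace I x)]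
  [IsContMDiffRiemannianBundle J ∞ F (fun y : N ↦ TangentSpace J y)]

/-- Horizontal components of covariant derivatives of basic vector fields. -/
theorem mfderiv_nabla (h : IsBasicFrameNear φ ε e' x) (hφ : IsRiemannianSubmersion I J φ)
    (a b : Fin 2) : mfderiv I J φ x (nabla (ε a.castSucc) (ε b.castSucc) x) =
      leviCivita J N (e' b) (φ x) (e' a (φ x)) := by
  refine h.base.ext_inner fun c ↦ ?_
  rw [h.base.inner_leviCivita, ← h.related.self_of_nhds c, real_inner_comm,
    ← hφ.inner_eq (h.isHorizontal c), real_inner_comm, nabla, h.inner_leviCivita]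
  simp only [christoffel, h.structureFun_eq hφ]

/-- The Koszul formula sees the same structure functions upstairs and downstairs, so dφ(∇_{εₐ}ε_b)
is the covariant derivative on the base, which is also what the pull-back connection gives. -/
theorem secondFundamentalForm_horizontal (h : IsBasicFrameNear φ ε e' x)
    (hφ : IsRiemannianSubmersion I J φ) (a b : Fin 2) :
    secondFundamentalForm I J φ (ε a.castSucc) (ε b.castSucc) x = 0 := by
  rw [secondFundamentalForm, h.mfderiv_nabla hφ,
    pullbackNabla_congr (h.related.mono fun y hy ↦ hy b),
    pullbackNabla_comp (hφ.contMDiff.mdifferentiable (by simp) x) (h.base.mdifferentiableAt b),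
    h.related.self_of_nhds a, sub_self]

theorem secondFundamentalForm_vertical (h : IsNaturalFrameNear J φ ε x)
    (hφ : IsRiemannianSubmersion I J φ) :
    secondFundamentalForm I J φ (ε 2) (ε 2) x = -mfderiv I J φ x (nabla (ε 2) (ε 2) x) := by
  have h1 := pullbackNabla_comp (V := (0 : (y : N) → TangentSpace J y))
    (hφ.contMDiff.mdifferentiable (by simp) x) (mdifferentiable_zeroSection _ _ _) (ε 2 x)
  rw [secondFundamentalForm, pullbackNabla_congr (s' := fun y ↦ (0 : (y : N) → TangentSpace J y)
    (φ y)) h.vertical, h1, CovariantDerivative.zero]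
  simp

end IsBasicFrameNear

variable [IsContMDiffRiemannianBundle I ∞ E (fun x : M ↦ TangentSpace I x)]
  [IsContMDiffRiemannianBundle J ∞ F (fun y : N ↦ TangentSpace J y)]
  {e : Fin 3 → (x : M) → TangentSpace I x}

namespace IsNaturalFrameNear

/-- The tension field of a Riemannian submersion with one-dimensional fibres. -/
theorem tensionField_eq (h : IsNaturalFrameNear J φ e x) (hφ : IsRiemannianSubmersion I J φ)
    (hF : Module.finrank ℝ F = 2) :
    tensionField I J φ x = -∑ a : Fin 2, structureFun e a.castSucc 2 2 x •
      mfderiv I J φ x (e a.castSucc x) := by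
  obtain ⟨ε, e', hε, hx, h2⟩ := h.exists_isBasicFrameNear hφ hF
  -- The horizontal components of ∇_{e₃}e₃ are κ₁ and κ₂.
  have h1 : ∀ a : Fin 2, christoffel e 2 2 a.castSucc x = structureFun e a.castSucc 2 2 x := by
    intro a
    rw [christoffel, structureFun_self, structureFun_swap e 2 a.castSucc 2]
    simp only [Pi.zero_apply, Pi.neg_apply]
    ring
  rw [tensionField_eq_sum hφ.contMDiff hε.toIsOrthonormalFrameNear, Fin.sum_univ_castSucc]
  simp only [hε.secondFundamentalForm_horizontal hφ, Finset.sum_const_zero, zero_add]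
  change secondFundamentalForm I J φ (ε 2) (ε 2) x = _
  rw [h2, IsBasicFrameNear.secondFundamentalForm_vertical h hφ, nabla, h.leviCivita_eq,
    Fin.sum_univ_castSucc, map_add, map_sum]
  change -(_ + mfderiv I J φ x (christoffel e 2 2 2 x • e 2 x)) = _
  rw [map_smul, h.mfderiv_vertical]
  simp only [map_smul, h1, smul_zero, add_zero]

theorem tensionField_eq_zero_iff (h : IsNaturalFrameNear J φ e x)
    (hφ : IsRiemannianSubmersion I J φ) (hF : Module.finrank ℝ F = 2) :
    tensionField I J φ x = 0 ↔ ∀ a : Fin 2, structureFun e a.castSucc 2 2 x = 0 := by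
  rw [h.tensionField_eq hφ hF, neg_eq_zero]
  refine ⟨fun h0 ↦ ?_, fun h0 ↦ by simp [h0]⟩
  exact Fintype.linearIndependent_iff.1 (h.orthonormal_mfderiv hφ).linearIndependent _ h0

/-- A natural frame in terms of a basic frame. -/
theorem eventually_eq_sum (h : IsNaturalFrameNear J φ e x) (hε : IsNaturalFrameNear J φ ε x)
    (a : Fin 2) : ∀ᶠ y in 𝓝 x, e a.castSucc y =
      ∑ c : Fin 2, (inner ℝ (e a.castSucc y) (ε c.castSucc y) : ℝ) • ε c.castSucc y := by
  filter_upwards [h.horizontal, hε.eventually_natural] with y h1 h2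
  conv_lhs => rw [← h2.sum_inner_smul (e a.castSucc y)]
  rw [Fin.sum_univ_castSucc]
  have h3 : (inner ℝ (e a.castSucc y) (ε 2 y) : ℝ) = 0 := h1 a _ h2.mfderiv_vertical
  change _ + (inner ℝ (e a.castSucc y) (ε 2 y) : ℝ) • ε 2 y = _
  rw [h3, zero_smul, add_zero]

theorem mlieBracket_eq_sum (h : IsNaturalFrameNear J φ e x) (hε : IsNaturalFrameNear J φ ε x)
    (Y : (x : M) → TangentSpace I x) (a : Fin 2) :
    mlieBracket I (e a.castSucc) Y x =
      ∑ c : Fin 2, ((inner ℝ (e a.castSucc x) (ε c.castSucc x) : ℝ) •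
        mlieBracket I (ε c.castSucc) Y x -
        mvfderiv I (fun y ↦ (inner ℝ (e a.castSucc y) (ε c.castSucc y) : ℝ)) x (Y x) •
          ε c.castSucc x) := by
  rw [EventuallyEq.mlieBracket_vectorField_eq (h.eventually_eq_sum hε a)
    (EventuallyEq.refl (𝓝 x) Y)]
  exact mlieBracket_sum_smul_left (fun c ↦ mdiffAt_inner (h.mdifferentiableAt _)
    (hε.mdifferentiableAt _)) fun c ↦ hε.mdifferentiableAt _

/-- The frames differ by functions multiplying horizontal fields; derivatives of these functions
contribute only horizontal vectors to the bracket, leaving its vertical component unchanged. -/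
theorem inner_mlieBracket_vertical (h : IsNaturalFrameNear J φ e x) (hε : IsBasicFrameNear φ ε e' x)
    (hx : ∀ i, ε i x = e i x)
    (Y : (x : M) → TangentSpace I x) (a : Fin 2) :
    (inner ℝ (mlieBracket I (e a.castSucc) Y x) (e 2 x) : ℝ) =
      inner ℝ (mlieBracket I (ε a.castSucc) Y x) (ε 2 x) := by
  rw [h.mlieBracket_eq_sum hε.toIsNaturalFrameNear]
  simp only [hx, h.inner_eq, sum_inner, inner_sub_left, inner_smul_left, RCLike.conj_to_real]
  simp

/-- σ is tensorial: the previous principle replaces one field, and antisymmetry of the bracket lets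
it replace the other. -/
theorem structureFun_zero_one_two (h : IsNaturalFrameNear J φ e x) (hε : IsBasicFrameNear φ ε e' x)
    (hx : ∀ i, ε i x = e i x) :
    structureFun e 0 1 2 x = structureFun ε 0 1 2 x := by
  have h1 := h.inner_mlieBracket_vertical hε hx (e 1) 0
  have h3 := h.inner_mlieBracket_vertical hε hx (ε 0) 1
  have h4 := mlieBracket_swap_apply (I := I) (V := ε 0) (W := e 1) (x := x)
  have h5 := mlieBracket_swap_apply (I := I) (V := ε 0) (W := ε 1) (x := x)
  refine h1.trans ?_
  change (inner ℝ (mlieBracket I (ε 0) (e 1) x) (ε 2 x) : ℝ) =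
    inner ℝ (mlieBracket I (ε 0) (ε 1) x) (ε 2 x)
  rw [h4, h5, inner_neg_left, inner_neg_left, hx 2]
  rw [hx 2] at h3
  exact congrArg _ h3

/-- Brackets of basic fields with e₃ are vertical, so the horizontal part of [eₐ,e₃] only records
how the natural frame turns against the basic one along the fibre. -/
theorem structureFun_vertical_eq (h : IsNaturalFrameNear J φ e x) (hε : IsBasicFrameNear φ ε e' x)
    (hx : ∀ i, ε i x = e i x)
    (h2 : ε 2 = e 2) (hφ : IsRiemannianSubmersion I J φ) (a b : Fin 2) :
    structureFun e a.castSucc 2 b.castSucc x =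
    -mvfderiv I (fun y ↦ (inner ℝ (e a.castSucc y) (ε b.castSucc y) : ℝ)) x (e 2 x) := by
  have h1 : ∀ c b : Fin 2, (inner ℝ (mlieBracket I (ε c.castSucc) (e 2) x) (e b.castSucc x) : ℝ) =
      0 := by
    intro c b
    have := hε.structureFun_vertical hφ c b
    rwa [structureFun, h2, hx] at this
  rw [structureFun, h.mlieBracket_eq_sum hε.toIsNaturalFrameNear]
  simp only [hx, h.inner_eq, sum_inner, inner_sub_left, inner_smul_left, RCLike.conj_to_real, h1,
    mul_zero, zero_sub]
  simp

/-- The flow of the vertical vector field preserves the horizontal part of the metric. -/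
theorem structureFun_vertical_swap (h : IsNaturalFrameNear J φ e x)
    (hφ : IsRiemannianSubmersion I J φ) (hF : Module.finrank ℝ F = 2) (a b : Fin 2) :
    structureFun e a.castSucc 2 b.castSucc x = -structureFun e b.castSucc 2 a.castSucc x := by
  obtain ⟨ε, e', hε, hx, h2⟩ := h.exists_isBasicFrameNear hφ hF
  rw [h.structureFun_vertical_eq hε hx h2 hφ, h.structureFun_vertical_eq hε hx h2 hφ, neg_neg,
    neg_eq_iff_add_eq_zero]
  let w (a c : Fin 2) : M → ℝ := fun y ↦ inner ℝ (e a.castSucc y) (ε c.castSucc y)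
  have hw : ∀ a c : Fin 2, MDiffAt (w a c) x :=
    fun a c ↦ mdiffAt_inner (h.mdifferentiableAt _) (hε.mdifferentiableAt _)
  -- The transition matrix `w` is orthogonal near `x` and the identity at `x`, so differentiating
  -- this relation along the vertical field shows that its derivative is skew.
  have hsum : w a 0 * w b 0 + w a 1 * w b 1 =ᶠ[𝓝 x] fun _ ↦ if a = b then 1 else 0 := by
    filter_upwards [h.eventually_eq_sum hε.toIsNaturalFrameNear b, h.eventually] with y h3 h4
    have h5 := h4.inner_eq a.castSucc b.castSucc
    rw [h3, inner_sum, Fin.sum_univ_two] at h5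
    simp only [inner_smul_right, Fin.castSucc_inj] at h5
    rw [← h5]
    simp only [Pi.add_apply, Pi.mul_apply, w]
    ring
  have h6 := mvfderiv_congr (I := I) hsum
  rw [mvfderiv_const, mvfderiv_add ((hw a 0).mul (hw b 0)) ((hw a 1).mul (hw b 1)),
    mvfderiv_mul (hw a 0) (hw b 0), mvfderiv_mul (hw a 1) (hw b 1)] at h6
  have h7 := congrArg (fun L : TangentSpace I x →L[ℝ] ℝ ↦ L (e 2 x)) h6
  simp only [add_apply, smul_apply, smul_eq_mul, zero_apply, w, hx, h.inner_eq] at h7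
  fin_cases a <;> fin_cases b <;> simpa [add_comm] using h7

end IsNaturalFrameNear

end BasicFrames

end

end HarmonicSubmersion

namespace HarmonicSubmersion

open VectorField Filter
open scoped Topology

noncomputable section

/-! ### The Jacobi identity and the curvature in a natural frame. -/

section NaturalCurvature

variable {E : Type*} [NormedAddCommGroup E] [NormedSpace ℝ E] [FiniteDimensional ℝ E]
  {H : Type*} [TopologicalSpace H] {I : ModelWithCorners ℝ E H}
  {M : Type*} [TopologicalSpace M] [ChartedSpace H M] [IsManifold I ∞ M]
  [RiemannianBundle (fun x : M ↦ TangentSpace I x)]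
  [IsContMDiffRiemannianBundle I ∞ E (fun x : M ↦ TangentSpace I x)] {x : M}

namespace IsOrthonormalFrameNear

variable {ι : Type*} [Fintype ι] {e : ι → (x : M) → TangentSpace I x}

theorem inner_mlieBracket_mlieBracket (h : IsOrthonormalFrameNear e x) (i j k l : ι) :
    (inner ℝ (mlieBracket I (mlieBracket I (e j) (e k)) (e i) x) (e l x) : ℝ) =
      ∑ m, structureFun e j k m x * structureFun e m i l x -
        mvfderiv I (structureFun e j k l) x (e i x) := by
  classical
  have h1 : mlieBracket I (e j) (e k) =ᶠ[𝓝 x] fun y ↦ ∑ m, structureFun e j k m y • e m y := by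
    filter_upwards [h.eventually] with y hy using hy.mlieBracket_eq j k
  have h2 : mlieBracket I (mlieBracket I (e j) (e k)) (e i) x =
      ∑ m, (structureFun e j k m x • mlieBracket I (e m) (e i) x -
        mvfderiv I (structureFun e j k m) x (e i x) • e m x) :=
    (EventuallyEq.mlieBracket_vectorField_eq h1 (EventuallyEq.refl (𝓝 x) (e i))).trans
      (mlieBracket_sum_smul_left (h.mdifferentiableAt_structureFun j k) h.mdifferentiableAt)
  rw [h2]
  simp only [sum_inner, inner_sub_left, inner_smul_left, RCLike.conj_to_real, h.inner_eq,
    Finset.sum_sub_distrib]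
  simp [structureFun]

/-- The Jacobi identity in terms of structure functions. -/
theorem jacobi (h : IsOrthonormalFrameNear e x) (i j k l : ι) :
    mvfderiv I (structureFun e j k l) x (e i x) -
        ∑ m, structureFun e j k m x * structureFun e m i l x =
      (∑ m, structureFun e i j m x * structureFun e m k l x -
        mvfderiv I (structureFun e i j l) x (e k x)) -
      (∑ m, structureFun e i k m x * structureFun e m j l x -
        mvfderiv I (structureFun e i k l) x (e j x)) := by
  have : CompleteSpace E := FiniteDimensional.complete ℝ E
  have : IsManifold I (minSmoothness ℝ 3) M := by
    simp only [minSmoothness_of_isRCLikeNormedField]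
    infer_instance
  have hs : ∀ i, CMDiffAt (minSmoothness ℝ 2) (T% (e i)) x := fun i ↦
    (h.smooth i).contMDiffAt.of_le
      (by simp only [minSmoothness_of_isRCLikeNormedField]; exact ENat.LEInfty.out)
  have h1 := leibniz_identity_mlieBracket_apply (hs i) (hs j) (hs k)
  rw [mlieBracket_swap_apply (V := e i), mlieBracket_swap_apply (V := e j)
    (W := mlieBracket I (e i) (e k))] at h1
  have h2 := congrArg (fun v : TangentSpace I x ↦ (inner ℝ v (e l x) : ℝ)) h1
  simp only [inner_neg_left, inner_add_left, h.inner_mlieBracket_mlieBracket] at h2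
  linarith

end IsOrthonormalFrameNear

variable [I.Boundaryless]
  {F : Type*} [NormedAddCommGroup F] [NormedSpace ℝ F] [FiniteDimensional ℝ F]
  {G : Type*} [TopologicalSpace G] {J : ModelWithCorners ℝ F G} [J.Boundaryless]
  {N : Type*} [TopologicalSpace N] [ChartedSpace G N] [IsManifold J ∞ N]
  [RiemannianBundle (fun y : N ↦ TangentSpace J y)]
  [IsContMDiffRiemannianBundle J ∞ F (fun y : N ↦ TangentSpace J y)]
  {φ : M → N} {e : Fin 3 → (x : M) → TangentSpace I x}

namespace IsNaturalFrameNear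

theorem structureFun_relations (h : IsNaturalFrameNear J φ e x) (hφ : IsRiemannianSubmersion I J φ)
    (hF : Module.finrank ℝ F = 2) :
    structureFun e 0 2 0 x = 0 ∧ structureFun e 1 2 1 x = 0 ∧
      structureFun e 1 2 0 x = -structureFun e 0 2 1 x := by
  have h1 : structureFun e 0 2 0 x = -structureFun e 0 2 0 x :=
    h.structureFun_vertical_swap hφ hF 0 0
  have h2 : structureFun e 1 2 1 x = -structureFun e 1 2 1 x :=
    h.structureFun_vertical_swap hφ hF 1 1
  exact ⟨by linarith, by linarith, h.structureFun_vertical_swap hφ hF 1 0⟩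

/-- The relations hold on a neighbourhood and may therefore be differentiated. -/
theorem mvfderiv_structureFun_relations (h : IsNaturalFrameNear J φ e x)
    (hφ : IsRiemannianSubmersion I J φ) (hF : Module.finrank ℝ F = 2) :
    mvfderiv I (structureFun e 0 2 0) x = 0 ∧ mvfderiv I (structureFun e 1 2 1) x = 0 ∧
      mvfderiv I (structureFun e 1 2 0) x = -mvfderiv I (structureFun e 0 2 1) x := by
  have hr : ∀ᶠ y in 𝓝 x, _ := h.eventually_natural.mono fun y hy ↦ hy.structureFun_relations hφ hF
  refine ⟨?_, ?_, ?_⟩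
  · rw [mvfderiv_congr (g := 0) (hr.mono fun y hy ↦ hy.1), mvfderiv_zero]
  · rw [mvfderiv_congr (g := 0) (hr.mono fun y hy ↦ hy.2.1), mvfderiv_zero]
  · rw [mvfderiv_congr (g := -structureFun e 0 2 1) (hr.mono fun y hy ↦ hy.2.2), mvfderiv_neg]

/-- The curvature in a natural frame in terms of its structure functions. -/
theorem curvature₄_natural (h : IsNaturalFrameNear J φ e x)
    (hφ : IsRiemannianSubmersion I J φ) (hF : Module.finrank ℝ F = 2) :
    curvature₄ (e 0) (e 2) (e 0) (e 1) x = mvfderiv I (structureFun e 0 1 2) x (e 0 x) / 2 -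
        structureFun e 0 2 2 x * structureFun e 0 1 2 x ∧
    curvature₄ (e 0) (e 2) (e 0) (e 2) x = mvfderiv I (structureFun e 0 2 2) x (e 0 x) +
        structureFun e 0 1 2 x ^ 2 / 4 - structureFun e 0 2 2 x ^ 2 +
        structureFun e 1 2 2 x * structureFun e 0 1 0 x ∧
    curvature₄ (e 0) (e 2) (e 1) (e 2) x = mvfderiv I (structureFun e 1 2 2) x (e 0 x) +
        mvfderiv I (structureFun e 0 1 2) x (e 2 x) / 2 -
        structureFun e 0 2 2 x * structureFun e 0 1 0 x -
        structureFun e 0 2 2 x * structureFun e 1 2 2 x ∧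
    curvature₄ (e 0) (e 1) (e 0) (e 1) x = mvfderiv I (structureFun e 0 1 1) x (e 0 x) -
        mvfderiv I (structureFun e 0 1 0) x (e 1 x) - structureFun e 0 1 0 x ^ 2 -
        structureFun e 0 1 1 x ^ 2 - structureFun e 0 2 1 x * structureFun e 0 1 2 x -
        3 / 4 * structureFun e 0 1 2 x ^ 2 ∧
    curvature₄ (e 0) (e 1) (e 1) (e 2) x = mvfderiv I (structureFun e 0 1 2) x (e 1 x) / 2 -
        structureFun e 1 2 2 x * structureFun e 0 1 2 x ∧
    curvature₄ (e 1) (e 2) (e 0) (e 2) x = mvfderiv I (structureFun e 0 2 2) x (e 1 x) -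
        mvfderiv I (structureFun e 0 1 2) x (e 2 x) / 2 +
        structureFun e 1 2 2 x * structureFun e 0 1 1 x -
        structureFun e 0 2 2 x * structureFun e 1 2 2 x ∧
    curvature₄ (e 1) (e 2) (e 1) (e 2) x = mvfderiv I (structureFun e 1 2 2) x (e 1 x) +
        structureFun e 0 1 2 x ^ 2 / 4 - structureFun e 1 2 2 x ^ 2 -
        structureFun e 0 2 2 x * structureFun e 0 1 1 x ∧
    mvfderiv I (structureFun e 0 1 2) x (e 2 x) =
        mvfderiv I (structureFun e 0 2 2) x (e 1 x) - mvfderiv I (structureFun e 1 2 2) x (e 0 x) +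
        structureFun e 0 2 2 x * structureFun e 0 1 0 x +
        structureFun e 1 2 2 x * structureFun e 0 1 1 x := by
  obtain ⟨r1, r2, r3⟩ := h.structureFun_relations hφ hF
  obtain ⟨d1, d2, d3⟩ := h.mvfderiv_structureFun_relations hφ hF
  have j0 := h.jacobi 0 1 2 0
  have j1 := h.jacobi 0 1 2 1
  have j2 := h.jacobi 0 1 2 2
  simp only [h.curvature₄_eq, h.mvfderiv_christoffel]
  simp only [Fin.sum_univ_three, christoffel, structureFun_self, structureFun_swap e 1 0,
    structureFun_swap e 2 0, structureFun_swap e 2 1, mvfderiv_neg, mvfderiv_zero, Pi.neg_apply,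
    Pi.zero_apply, smul_apply, sub_apply, neg_apply, zero_apply, smul_eq_mul, r1, r2, r3, d1, d2,
    d3] at j0 j1 j2 ⊢
  refine ⟨?_, ?_, ?_, ?_, ?_, ?_, ?_, ?_⟩
  -- The raw expression contains e₁(f₃) - e₃(f₁); the e₁-component of the Jacobi identity turns this
  -- difference into quadratic terms.
  · ring_nf at j0 ⊢
    linarith
  · ring
  · ring
  · ring
  · ring
  · ring
  · ring
  -- This is the e₃-component of the Jacobi identity.
  · ring_nf at j2 ⊢
    linarith

end IsNaturalFrameNear

end NaturalCurvature

end

end HarmonicSubmersion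

namespace HarmonicSubmersion

open VectorField Filter
open scoped Topology

noncomputable section

set_option linter.unusedSectionVars false

/-! ### O'Neill's formula for the horizontal plane. -/

section GaussCurvature

variable {E : Type*} [NormedAddCommGroup E] [NormedSpace ℝ E] [FiniteDimensional ℝ E]
  {H : Type*} [TopologicalSpace H] {I : ModelWithCorners ℝ E H} [I.Boundaryless]
  {M : Type*} [TopologicalSpace M] [ChartedSpace H M] [IsManifold I ∞ M]
  [RiemannianBundle (fun x : M ↦ TangentSpace I x)]
  [IsContMDiffRiemannianBundle I ∞ E (fun x : M ↦ TangentSpace I x)]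
  {F : Type*} [NormedAddCommGroup F] [NormedSpace ℝ F] [FiniteDimensional ℝ F]
  {G : Type*} [TopologicalSpace G] {J : ModelWithCorners ℝ F G} [J.Boundaryless]
  {N : Type*} [TopologicalSpace N] [ChartedSpace G N] [IsManifold J ∞ N]
  [RiemannianBundle (fun y : N ↦ TangentSpace J y)]
  [IsContMDiffRiemannianBundle J ∞ F (fun y : N ↦ TangentSpace J y)]
  {φ : M → N} {x : M} {ε e : Fin 3 → (x : M) → TangentSpace I x}
  {e' : Fin 2 → (y : N) → TangentSpace J y}

theorem IsBasicFrameNear.mvfderiv_structureFun (h : IsBasicFrameNear φ ε e' x)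
    (hφ : IsRiemannianSubmersion I J φ) (a b c d : Fin 2) :
    mvfderiv I (structureFun ε a.castSucc b.castSucc c.castSucc) x (ε d.castSucc x) =
      mvfderiv J (structureFun e' a b c) (φ x) (e' d (φ x)) := by
  rw [mvfderiv_congr (g := structureFun e' a b c ∘ φ)
      ((h.eventually_basic hφ).mono fun y hy ↦ hy.structureFun_eq hφ a b c),
    ← h.related.self_of_nhds d]
  exact mvfderiv_comp_apply x (h.base.mdifferentiableAt_structureFun a b c)
    (hφ.contMDiff.mdifferentiable (by simp) x) _

/-- O'Neill's formula for the curvature of the horizontal plane. -/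
theorem IsNaturalFrameNear.sectionalCurvature_eq_add (h : IsNaturalFrameNear J φ e x)
    (hφ : IsRiemannianSubmersion I J φ) (hF : Module.finrank ℝ F = 2)
    {u v : TangentSpace J (φ x)} (huv : LinearIndependent ℝ ![u, v]) :
    sectionalCurvature u v = curvature₄ (e 0) (e 1) (e 0) (e 1) x +
      3 / 4 * structureFun e 0 1 2 x ^ 2 := by
  obtain ⟨ε, e', hε, hx, -⟩ := h.exists_isBasicFrameNear hφ hF
  -- Curvature is tensorial, so it may be computed in the basic frame. There f₃ = 0 and f₁, f₂ and
  -- their horizontal derivatives come from the base, so the natural-frame formula reduces to the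
  -- base curvature minus 3σ².
  have h1 : curvature₄ (e 0) (e 1) (e 0) (e 1) x = curvature₄ (ε 0) (ε 1) (ε 0) (ε 1) x :=
    h.curvature₄_congr (h.mdifferentiableAt 0) (h.mdifferentiableAt 1) (h.smooth 1)
      (hε.mdifferentiableAt 0) (hε.mdifferentiableAt 1) (hε.smooth 1) (hx 0).symm (hx 1).symm
      (hx 0).symm (hx 1).symm
  have h2 : structureFun ε 0 2 1 x = 0 := hε.structureFun_vertical hφ 0 1
  have h3 : structureFun ε 0 1 0 x = structureFun e' 0 1 0 (φ x) := hε.structureFun_eq hφ 0 1 0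
  have h4 : structureFun ε 0 1 1 x = structureFun e' 0 1 1 (φ x) := hε.structureFun_eq hφ 0 1 1
  have h5 : mvfderiv I (structureFun ε 0 1 1) x (ε 0 x) =
      mvfderiv J (structureFun e' 0 1 1) (φ x) (e' 0 (φ x)) := hε.mvfderiv_structureFun hφ 0 1 1 0
  have h6 : mvfderiv I (structureFun ε 0 1 0) x (ε 1 x) =
      mvfderiv J (structureFun e' 0 1 0) (φ x) (e' 1 (φ x)) := hε.mvfderiv_structureFun hφ 0 1 0 1
  rw [hε.base.sectionalCurvature_eq huv, hε.base.curvature₄_fin_two, h1,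
    (hε.curvature₄_natural hφ hF).2.2.2.1, h.structureFun_zero_one_two hε hx, h2, h3, h4, h5, h6]
  ring

end GaussCurvature

/-! ### Translation to dimensions 3 and 2 and to the integrability data. -/

section Surface

variable {M : Type*} [TopologicalSpace M] [ChartedSpace (EuclideanSpace ℝ (Fin 3)) M]
  [IsManifold (𝓡 3) ∞ M] [RiemannianBundle (fun x : M ↦ TangentSpace (𝓡 3) x)]
  [IsContMDiffRiemannianBundle (𝓡 3) ∞ (EuclideanSpace ℝ (Fin 3))
    (fun x : M ↦ TangentSpace (𝓡 3) x)]
  {N : Type*} [TopologicalSpace N] [ChartedSpace (EuclideanSpace ℝ (Fin 2)) N]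
  [IsManifold (𝓡 2) ∞ N] [RiemannianBundle (fun y : N ↦ TangentSpace (𝓡 2) y)]
  [IsContMDiffRiemannianBundle (𝓡 2) ∞ (EuclideanSpace ℝ (Fin 2))
    (fun y : N ↦ TangentSpace (𝓡 2) y)]
  {φ : M → N} {U : Set M} {e₁ e₂ e₃ : (x : M) → TangentSpace (𝓡 3) x} {x : M}

theorem linearIndependent_single_zero_single_one : LinearIndependent ℝ
    ![(EuclideanSpace.single 0 1 : EuclideanSpace ℝ (Fin 2)), EuclideanSpace.single 1 1] := by
  refine LinearIndependent.pair_iff.2 fun s t h ↦ ⟨?_, ?_⟩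
  · simpa using congrArg (fun v : EuclideanSpace ℝ (Fin 2) ↦ v 0) h
  · simpa using congrArg (fun v : EuclideanSpace ℝ (Fin 2) ↦ v 1) h

theorem IsNaturalFrameOn.isNaturalFrameNear (he : IsNaturalFrameOn φ U e₁ e₂ e₃) (hU : IsOpen U)
    (hx : x ∈ U) : IsNaturalFrameNear (𝓡 2) φ ![e₁, e₂, e₃] x where
  smooth := by
    intro i
    filter_upwards [hU.mem_nhds hx] with y hy
    fin_cases i
    · exact he.smooth₁.contMDiffAt (hU.mem_nhds hy)
    · exact he.smooth₂.contMDiffAt (hU.mem_nhds hy)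
    · exact he.smooth₃.contMDiffAt (hU.mem_nhds hy)
  orthonormal := by
    filter_upwards [hU.mem_nhds hx] with y hy
    convert he.orthonormal y hy using 1
    funext i
    fin_cases i <;> rfl
  card_eq := by simp
  horizontal := by
    filter_upwards [hU.mem_nhds hx] with y hy a
    fin_cases a
    · exact he.horizontal₁ y hy
    · exact he.horizontal₂ y hy
  vertical := by
    filter_upwards [hU.mem_nhds hx] with y hy using he.vertical₃ y hy

theorem dirDeriv_integrabilityData_σ (he : IsNaturalFrameOn φ U e₁ e₂ e₃) (hU : IsOpen U)
    (hx : x ∈ U) (X : (x : M) → TangentSpace (𝓡 3) x) :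
    dirDeriv X (integrabilityData e₁ e₂ e₃).σ x =
      -(1 / 2) * mvfderiv (𝓡 3) (structureFun ![e₁, e₂, e₃] 0 1 2) x (X x) := by
  have h := (he.isNaturalFrameNear hU hx).mdifferentiableAt_structureFun 0 1 2
  have h1 : (integrabilityData e₁ e₂ e₃).σ =
      fun y ↦ (-(1 / 2) : ℝ) * structureFun ![e₁, e₂, e₃] 0 1 2 y := rfl
  rw [dirDeriv, h1, mvfderiv_fun_mul mdifferentiableAt_const h, mvfderiv_const]
  simp

theorem gaussCurvature_eq_add (hφ : IsRiemannianSubmersion (𝓡 3) (𝓡 2) φ)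
    (he : IsNaturalFrameOn φ U e₁ e₂ e₃) (hU : IsOpen U) (hx : x ∈ U) :
    gaussCurvature (φ x) = curvature₄ e₁ e₂ e₁ e₂ x +
      3 * (integrabilityData e₁ e₂ e₃).σ x ^ 2 := by
  have h1 := (he.isNaturalFrameNear hU hx).sectionalCurvature_eq_add hφ (by simp)
    linearIndependent_single_zero_single_one
  have h2 : (integrabilityData e₁ e₂ e₃).σ x =
      (-(1 / 2) : ℝ) * structureFun ![e₁, e₂, e₃] 0 1 2 x := rfl
  refine h1.trans ?_
  rw [h2]
  change curvature₄ e₁ e₂ e₁ e₂ x + _ = _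
  ring

/-- The link between harmonicity and the integrability data: dπ(e₁) and dπ(e₂) are linearly
independent, so their combination -κ₁dπ(e₁) - κ₂dπ(e₂) vanishes only trivially. -/
theorem tensionField_eq_zero_iff_κ (hφ : IsRiemannianSubmersion (𝓡 3) (𝓡 2) φ)
    (he : IsNaturalFrameOn φ U e₁ e₂ e₃) (hU : IsOpen U) (hx : x ∈ U) :
    tensionField (𝓡 3) (𝓡 2) φ x = 0 ↔ (integrabilityData e₁ e₂ e₃).κ₁ x = 0 ∧
      (integrabilityData e₁ e₂ e₃).κ₂ x = 0 := by
  rw [(he.isNaturalFrameNear hU hx).tensionField_eq_zero_iff hφ (by simp), Fin.forall_fin_two]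
  rfl

/-- The curvature in a natural frame in terms of the generalized integrability data. -/
theorem curvature₄_integrabilityData (hφ : IsRiemannianSubmersion (𝓡 3) (𝓡 2) φ)
    (he : IsNaturalFrameOn φ U e₁ e₂ e₃) (hU : IsOpen U) (hx : x ∈ U)
    (D : IntegrabilityData M) (hD : D = integrabilityData e₁ e₂ e₃) :
    curvature₄ e₁ e₃ e₁ e₂ x = -dirDeriv e₁ D.σ x + 2 * D.κ₁ x * D.σ x ∧
    curvature₄ e₁ e₃ e₁ e₃ x = dirDeriv e₁ D.κ₁ x + D.σ x ^ 2 - D.κ₁ x ^ 2 +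
      D.κ₂ x * D.f₁ x ∧
    curvature₄ e₁ e₃ e₂ e₃ x = dirDeriv e₁ D.κ₂ x - dirDeriv e₃ D.σ x - D.κ₁ x * D.f₁ x -
      D.κ₁ x * D.κ₂ x ∧
    curvature₄ e₁ e₂ e₁ e₂ x = dirDeriv e₁ D.f₂ x - dirDeriv e₂ D.f₁ x - D.f₁ x ^ 2 -
      D.f₂ x ^ 2 + 2 * D.f₃ x * D.σ x - 3 * D.σ x ^ 2 ∧
    curvature₄ e₁ e₂ e₂ e₃ x = -dirDeriv e₂ D.σ x + 2 * D.κ₂ x * D.σ x ∧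
    curvature₄ e₂ e₃ e₁ e₃ x = dirDeriv e₂ D.κ₁ x + dirDeriv e₃ D.σ x + D.κ₂ x * D.f₂ x -
      D.κ₁ x * D.κ₂ x ∧
    curvature₄ e₂ e₃ e₂ e₃ x = dirDeriv e₂ D.κ₂ x + D.σ x ^ 2 - D.κ₂ x ^ 2 -
      D.κ₁ x * D.f₂ x ∧
    -2 * dirDeriv e₃ D.σ x = dirDeriv e₂ D.κ₁ x - dirDeriv e₁ D.κ₂ x + D.κ₁ x * D.f₁ x +
      D.κ₂ x * D.f₂ x := by
  have hs := dirDeriv_integrabilityData_σ he hU hx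
  have hσ : D.σ x = (-(1 / 2) : ℝ) * structureFun ![e₁, e₂, e₃] 0 1 2 x := by rw [hD]; rfl
  rw [← hD] at hs
  have hf₁ : D.f₁ = structureFun ![e₁, e₂, e₃] 0 1 0 := by rw [hD]; rfl
  have hf₂ : D.f₂ = structureFun ![e₁, e₂, e₃] 0 1 1 := by rw [hD]; rfl
  have hf₃ : D.f₃ = structureFun ![e₁, e₂, e₃] 0 2 1 := by rw [hD]; rfl
  have hκ₁ : D.κ₁ = structureFun ![e₁, e₂, e₃] 0 2 2 := by rw [hD]; rfl
  have hκ₂ : D.κ₂ = structureFun ![e₁, e₂, e₃] 1 2 2 := by rw [hD]; rfl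
  have he₀ : ![e₁, e₂, e₃] 0 = e₁ := rfl
  have he₁ : ![e₁, e₂, e₃] 1 = e₂ := rfl
  have he₂ : ![e₁, e₂, e₃] 2 = e₃ := rfl
  obtain ⟨h1, h2, h3, h4, h5, h6, h7, h8⟩ :=
    (he.isNaturalFrameNear hU hx).curvature₄_natural hφ (by simp)
  simp only [he₀, he₁, he₂] at h1 h2 h3 h4 h5 h6 h7 h8
  rw [hs, hs, hs, hσ, h1, h2, h3, h4, h5, h6, h7, h8, hf₁, hf₂, hf₃, hκ₁, hκ₂]
  simp only [dirDeriv]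
  refine ⟨?_, ?_, ?_, ?_, ?_, ?_, ?_, ?_⟩ <;> linarith

theorem bracketRelationsAt_integrabilityData (hφ : IsRiemannianSubmersion (𝓡 3) (𝓡 2) φ)
    (he : IsNaturalFrameOn φ U e₁ e₂ e₃) (hU : IsOpen U) (hx : x ∈ U) :
    BracketRelationsAt e₁ e₂ e₃ (integrabilityData e₁ e₂ e₃) x := by
  have h := he.isNaturalFrameNear hU hx
  obtain ⟨r1, r2, r3⟩ := h.structureFun_relations hφ (by simp)
  have h1 := h.mlieBracket_eq 0 2
  have h2 := h.mlieBracket_eq 1 2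
  have h3 := h.mlieBracket_eq 0 1
  rw [Fin.sum_univ_three] at h1 h2 h3
  rw [r1, zero_smul, zero_add] at h1
  rw [r2, r3, zero_smul, add_zero] at h2
  refine ⟨h1, h2, h3.trans ?_⟩
  have h4 : 2 * (integrabilityData e₁ e₂ e₃).σ x = -structureFun ![e₁, e₂, e₃] 0 1 2 x := by
    change 2 * ((-(1 / 2) : ℝ) * structureFun ![e₁, e₂, e₃] 0 1 2 x) = _
    ring
  rw [h4, neg_smul, sub_neg_eq_add]
  rfl

theorem dirDeriv_eq_zero (hU : IsOpen U) (hx : x ∈ U) {f : M → ℝ} (hf : ∀ y ∈ U, f y = 0)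
    (X : (x : M) → TangentSpace (𝓡 3) x) : dirDeriv X f x = 0 := by
  have h : f =ᶠ[𝓝 x] 0 := by filter_upwards [hU.mem_nhds hx] with y hy using hf y hy
  rw [dirDeriv, mvfderiv_congr h, mvfderiv_zero]
  rfl

end Surface

end

end HarmonicSubmersion

/-! ### The main theorem. -/

theorem mainTheorem5
    {M : Type*} [TopologicalSpace M] [ChartedSpace (EuclideanSpace ℝ (Fin 3)) M]
    [IsManifold (𝓡 3) ∞ M] [RiemannianBundle (fun x : M ↦ TangentSpace (𝓡 3) x)]
    [IsContMDiffRiemannianBundle (𝓡 3) ∞ (EuclideanSpace ℝ (Fin 3))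
      (fun x : M ↦ TangentSpace (𝓡 3) x)]
    {N : Type*} [TopologicalSpace N] [ChartedSpace (EuclideanSpace ℝ (Fin 2)) N]
    [IsManifold (𝓡 2) ∞ N] [RiemannianBundle (fun y : N ↦ TangentSpace (𝓡 2) y)]
    [IsContMDiffRiemannianBundle (𝓡 2) ∞ (EuclideanSpace ℝ (Fin 2))
      (fun y : N ↦ TangentSpace (𝓡 2) y)]
    (φ : M → N) (hφ : IsRiemannianSubmersion (𝓡 3) (𝓡 2) φ)
    (U : Set M) (hU : IsOpen U)
    (e₁ e₂ e₃ : (x : M) → TangentSpace (𝓡 3) x) (he : IsNaturalFrameOn φ U e₁ e₂ e₃)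
    (D : IntegrabilityData M) (hD : D = integrabilityData e₁ e₂ e₃) :
    (∀ x ∈ U, BracketRelationsAt e₁ e₂ e₃ D x) ∧
    (∀ x ∈ U, gaussCurvature (φ x) =
      dirDeriv e₁ D.f₂ x - dirDeriv e₂ D.f₁ x - D.f₁ x ^ 2 - D.f₂ x ^ 2
        + 2 * D.f₃ x * D.σ x) ∧
    (IsHarmonicOn (𝓡 3) (𝓡 2) φ U → ∀ x ∈ U, CurvatureSystemAt φ e₁ e₂ e₃ D.σ x) ∧
    ((∀ x ∈ U, D.σ x ≠ 0) → (∀ x ∈ U, CurvatureSystemAt φ e₁ e₂ e₃ D.σ x) →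
      IsHarmonicOn (𝓡 3) (𝓡 2) φ U) := by
  subst hD
  have hc := fun x (hx : x ∈ U) ↦ curvature₄_integrabilityData hφ he hU hx _ rfl
  refine ⟨fun x hx ↦ bracketRelationsAt_integrabilityData hφ he hU hx, fun x hx ↦ ?_,
    fun hh x hx ↦ ?_, fun hσ hs x hx ↦ ?_⟩
  · rw [gaussCurvature_eq_add hφ he hU hx, (hc x hx).2.2.2.1]
    ring
  · have hκ := fun y (hy : y ∈ U) ↦ (tensionField_eq_zero_iff_κ hφ he hU hy).1 (hh y hy)
    -- Harmonicity on the whole open set is needed here: the derivatives of κ₁, κ₂ must vanish too.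
    -- The Jacobi relation `h8` then gives e₃(σ) = 0.
    have hd₁ := dirDeriv_eq_zero hU hx fun y hy ↦ (hκ y hy).1
    have hd₂ := dirDeriv_eq_zero hU hx fun y hy ↦ (hκ y hy).2
    have hK := gaussCurvature_eq_add hφ he hU hx
    obtain ⟨h1, h2, h3, -, h5, h6, h7, h8⟩ := hc x hx
    simp only [hd₁, hd₂, hκ x hx, zero_mul, mul_zero] at h1 h2 h3 h5 h6 h7 h8
    exact ⟨by linarith, by linarith, ⟨by linarith, by linarith⟩, by linarith, by linarith,
      ⟨by linarith, by linarith⟩, by linarith⟩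
  · obtain ⟨h1, -, -, -, h5, -, -, -⟩ := hc x hx
    -- Comparison with the general formulas leaves 2κ₁σ = 0 here and 2κ₂σ = 0 in the next line; σ ≠
    -- 0 can be divided out.
    rw [(hs x hx).eq1312] at h1
    rw [(hs x hx).eq1223] at h5
    rw [tensionField_eq_zero_iff_κ hφ he hU hx]
    have h2 := hσ x hx
    exact ⟨by simpa [h2] using h1, by simpa [h2] using h5⟩
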